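/- For an integer $r\ge 1$ let $[r]=\{0,\dots,r-1\}$. A nonempty set $\mathcal H$ of functions $U\to[r]$ on a finite set $U$ is \emph{$\kappa$-wise independent} if for all distinct $x_1,\dots,x_\kappa\in U$ and all $j_1,\dots,j_\kappa\in[r]$, a uniformly random $h\in\mathcal H$ satisfies $\Pr(h(x_1)=j_1\wedge\dots\wedge h(x_\kappa)=j_\kappa)=r^{-\kappa}$. Given $2k$-wise independent families $\mathcal H_m$ and $\mathcal H_\ell$ of functions from $U$ to $[m]$ and to $[\ell]$, respectively, the family $\mathcal Z^{2k,c}_{\ell,m}$ consists of the pairs $(h_1,h_2)$ with $$h_i(x)=\Bigl(f_i(x)+\sum_{j=1}^{c} z^{(i)}_j[g_j(x)]\Bigr)\bmod m,\qquad x\in U,\ i\in\{1,2\},$$ where $f_1,f_2\in\mathcal H_m$, $g_1,\dots,g_c\in\mathcal H_\ell$ and $z^{(i)}_j\in[m]^\ell$; a random pair is obtained by choosing all these components independently and uniformly at random. For $S\subseteq U$ the \emph{cuckoo graph} $G(S,h_1,h_2)$ is the bipartite multigraph whose two node sets are copies of $[m]$ and which has one edge $(h_1(x),h_2(x))$ for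 each $x\in S$. The \emph{excess} $\mathrm{ex}(G)$ of a multigraph $G$ is the minimum number of edges one has to remove from $G$ so that every connected component of the remaining graph has at most one cycle. \textbf{Theorem.} Let $\varepsilon>0$ and $0<\delta<1$ be real numbers, let $s\ge 0$ and $k\ge 1$ be integers, and let $c$ be an integer with $c\ge (s+2)/(\delta k)$. There is a constant $K$, depending only on $\varepsilon,\delta,s,k,c$, such that the following holds. Let $n\ge 1$ be an integer, let $m\ge(1+\varepsilon)n$ be an integer, let $\ell$ be $n^{\delta}$ rounded to an integer (up or down), let $U$ be a finite set, let $\mathcal H_m$ and $\mathcal H_\ell$ be arbitrary $2k$-wise independent families of functions from $U$ to $[m]$ and to $[\ell]$, and let $S\subseteq U$ with $|S|=n$. Then for $(h_1,h_2)$ chosen at random from $\mathcal Z^{2k,c}_{\ell,m}$, $$\Pr\bigl(\mathrm{ex}(G(S,h_1,h_2))\ge s+1\bigr)\le \frac{K}{n^{s+1}}.$$ Moreover, with probability at most $K/n^{s+1}$ it is impossible to store $S$ using $(h_1,h_2)$ in two tables of $m$ cells each together with a stash of size $s$, i.e. to choose at most $s$ keys of $S$ for the stash and to place each other key $x\in S$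 either in cell $h_1(x)$ of the first table or in cell $h_2(x)$ of the second table so that no cell receives two keys. -/

import Mathlib

universe u

noncomputable section

namespace CuckooStash

/-- The probability of the event `E` under the uniform distribution on a finite set `Ω`. -/
def unifProb {Ω : Type*} [Finite Ω] (E : Ω → Prop) : ℝ :=
  (Nat.card {ω : Ω // E ω} : ℝ) / (Nat.card Ω : ℝ)

/-- `H` is a (nonempty) `κ`-wise independent family of hash functions with range `[r]`: for a
uniformly random `h ∈ H`, arbitrary distinct keys `x 0, …, x (κ - 1)` and arbitrary values
`j 0, …, j (κ - 1)`, the probability that `h (x i) = j i` for all `i` is `1 / r ^ κ`. -/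
def KWiseIndependent {U : Type*} {r : ℕ} (κ : ℕ) (H : Finset (U → Fin r)) : Prop :=
  H.Nonempty ∧
    ∀ x : Fin κ → U, Function.Injective x → ∀ j : Fin κ → Fin r,
      unifProb (fun h : ↥H => ∀ i, (h : U → Fin r) (x i) = j i) = 1 / (r : ℝ) ^ κ

/-- The hash function `x ↦ (f x + ∑ j, z j [g j x]) mod m`. -/
def hashFun {U : Type*} {m l c : ℕ} (f : U → Fin m) (g : Fin c → U → Fin l)
    (z : Fin c → Fin l → Fin m) (x : U) : Fin m :=
  ⟨((f x : ℕ) + ∑ j, (z j (g j x) : ℕ)) % m, Nat.mod_lt _ (Fin.pos (f x))⟩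

/-- The family of all pairs of hash functions, each pair represented by its components:
`f₁, f₂` from `Hm`, the functions `g₁, …, g_c` from `Hl` (shared by both hash functions), and
the tables `z^{(i)}_1, …, z^{(i)}_c ∈ [m]^l` for `i = 1, 2`. -/
structure ZFamily {U : Type*} {m l : ℕ} (Hm : Finset (U → Fin m)) (Hl : Finset (U → Fin l))
    (c : ℕ) where
  f₁ : ↥Hm
  f₂ : ↥Hm
  g : Fin c → ↥Hl
  z₁ : Fin c → Fin l → Fin m
  z₂ : Fin c → Fin l → Fin m

namespace ZFamily

variable {U : Type*} {m l c : ℕ} {Hm : Finset (U → Fin m)} {Hl : Finset (U → Fin l)}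

/-- An element of the family is the tuple of its independent components. -/
def equivProd : ZFamily Hm Hl c ≃
    (↥Hm × ↥Hm × (Fin c → ↥Hl) × (Fin c → Fin l → Fin m) × (Fin c → Fin l → Fin m)) where
  toFun ω := (ω.f₁, ω.f₂, ω.g, ω.z₁, ω.z₂)
  invFun p := ⟨p.1, p.2.1, p.2.2.1, p.2.2.2.1, p.2.2.2.2⟩
  left_inv _ := rfl
  right_inv _ := rfl

instance : Finite (ZFamily Hm Hl c) := Finite.of_equiv _ equivProd.symm

/-- The first hash function of the pair. -/
def h₁ (ω : ZFamily Hm Hl c) : U → Fin m :=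
  hashFun (ω.f₁ : U → Fin m) (fun j => (ω.g j : U → Fin l)) ω.z₁

/-- The second hash function of the pair. -/
def h₂ (ω : ZFamily Hm Hl c) : U → Fin m :=
  hashFun (ω.f₂ : U → Fin m) (fun j => (ω.g j : U → Fin l)) ω.z₂

end ZFamily

/-- The cuckoo graph: the bipartite multigraph whose two node sets are copies of `[m]` and which
has, for every key `x ∈ S`, one edge (named `x`) between `h₁ x` on the left and `h₂ x` on the
right. -/
def cuckooGraph {U : Type*} {m : ℕ} (S : Finset U) (h₁ h₂ : U → Fin m) :
    Graph (Fin m ⊕ Fin m) U where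
  vertexSet := Set.univ
  edgeSet := {x | x ∈ S}
  IsLink x a b := x ∈ S ∧
    ((a = Sum.inl (h₁ x) ∧ b = Sum.inr (h₂ x)) ∨ (a = Sum.inr (h₂ x) ∧ b = Sum.inl (h₁ x)))
  isLink_symm := fun x _ => ⟨fun a b h => ⟨h.1, h.2.elim (fun h => Or.inr ⟨h.2, h.1⟩)
    (fun h => Or.inl ⟨h.2, h.1⟩)⟩⟩
  eq_or_eq_of_isLink_of_isLink := by
    rintro x a b v w ⟨_, h⟩ ⟨_, h'⟩
    rcases h with ⟨rfl, rfl⟩ | ⟨rfl, rfl⟩ <;> rcases h' with ⟨rfl, rfl⟩ | ⟨rfl, rfl⟩ <;> simp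
  edge_mem_iff_exists_isLink := fun x =>
    ⟨fun hx => ⟨_, _, hx, Or.inl ⟨rfl, rfl⟩⟩, fun ⟨_, _, h⟩ => h.1⟩
  left_mem_of_isLink := fun _ _ _ _ => Set.mem_univ _

section Excess

variable {α β : Type*}

/-- The (vertex set of the) connected component of the vertex `v`. -/
def component (G : Graph α β) (v : α) : Set α :=
  {w | Relation.ReflTransGen G.Adj v w}

/-- `C` is the edge set of a cycle of the multigraph `G` all of whose vertices lie in `W`: there
are distinct vertices `v 0, …, v r` in `W` and distinct edges `e 0, …, e r` such that `e i` joins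
`v i` and `v (i + 1)`, indices being taken modulo `r + 1`. A loop is a cycle of length one, a pair
of parallel edges a cycle of length two. A cycle is determined by its edge set. -/
def IsCycleIn (G : Graph α β) (W : Set α) (C : Set β) : Prop :=
  ∃ (r : ℕ) (v : Fin (r + 1) → α) (e : Fin (r + 1) → β),
    Function.Injective v ∧ Function.Injective e ∧ (∀ i, v i ∈ W) ∧
      (∀ i, G.IsLink (e i) (v i) (v (i + 1))) ∧ C = Set.range e

/-- Every connected component is acyclic (has no cycle) or unicyclic (has exactly one cycle). -/
def AllAcyclicOrUnicyclic (G : Graph α β) : Prop :=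
  ∀ v ∈ G.vertexSet,
    (¬ ∃ C, IsCycleIn G (component G v) C) ∨ (∃! C, IsCycleIn G (component G v) C)

/-- The excess of `G`: the minimum number of edges one has to remove from `G` so that all
connected components of the remaining graph are acyclic or unicyclic. -/
def excess (G : Graph α β) : ℕ∞ :=
  ⨅ (F : Set β) (_ : F ⊆ G.edgeSet) (_ : AllAcyclicOrUnicyclic (G.deleteEdges F)), F.encard

end Excess

/-- The keys from `S` can be stored using `(h₁, h₂)` in two tables with `m` cells each and a stash
of size `s`: at most `s` keys (the set `T`) go to the stash, and every other key `x` is put into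
the cell `h₁ x` of the first table or the cell `h₂ x` of the second table, no two keys sharing a
cell. -/
def CanStore {U : Type*} {m : ℕ} (S : Finset U) (h₁ h₂ : U → Fin m) (s : ℕ) : Prop :=
  ∃ T : Finset U, T ⊆ S ∧ T.card ≤ s ∧
    ∃ p : U → Fin m ⊕ Fin m,
      (∀ x, x ∈ S → x ∉ T → p x = Sum.inl (h₁ x) ∨ p x = Sum.inr (h₂ x)) ∧
      Set.InjOn p {x | x ∈ S ∧ x ∉ T}

end CuckooStash

end

/-!
# Cuckoo hashing with a stash under simple hash functions

A set of keys stored with a stash of size `s` leaves, after removal of the stash, a cuckoo graph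
whose edges are assigned injectively to their end points. The other end point of the edge assigned
to a node defines a functional graph on the nodes, and a component of a functional graph has at
most one cycle; so the excess is at most `s` (`excess_le_of_canStore`). Hence both failure events
are contained in the event that `S` cannot be stored, and only the latter has to be estimated.

If `S` cannot be stored, take a largest storable subset. For each of `s + 1` remaining keys, cuckoo
insertion (`IsStorage.exists_vacate`) never meets an empty cell, so that the kicks from both cells
of the key run in circles. Following them edge by edge gives a list of `t` keys whose edges satisfy
`t + s + 1` coincidences of end points (`exists_explored_of_not_canStore`): every edge begins at
the end of the previous one, with a bounded number `R` of exceptions. As the exceptions are few,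
only `m ^ (t - s - 1)` times a polynomial in `t` of the `m ^ (2 t)` edge lists have this shape
(`encard_exploredSet_le`). If the hash functions were fully random, the expected number of such
lists of keys would be at most `∑ n ^ t m ^ (-t - s - 1) poly(t)`, which is `O(n ^ (-s - 1))` as
`n / m ≤ 1 / (1 + ε)`.

The hash functions are indeed uniform on the list if some `g j` shrinks its set of keys by at most
`k` (`card_matching_mul_le`): at most `2 k` keys share their cell, on which `f` is uniform, and
each other key is randomized by a table entry of its own. All `c` functions shrink a set of `t`
keys by at least `k` with probability at most `(t ^ 2 / l) ^ (k c)` (`unifProb_shrink_le`), which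
is `O(t ^ (2 k c) n ^ (-s - 2))`. Since this has to be combined with uniform hash functions, the
list is replaced by an initial part of the exploration that is exceptional only because of its
latest key: some `g j` shrinks it by exactly `k` (`Shrinking.exists_suffix`). Such a part is still
explored with few exceptions and satisfies at least `t - 1` coincidences (`Explored.le_length`), so
that the expected number of them is at most `∑ n ^ t m ^ (-t + 1) poly(t) · O(n ^ (-s - 2))`, which
again is `O(n ^ (-s - 1))`.
-/

noncomputable section

namespace CuckooStash

open Finset
open scoped Classical

/-! ### Uniform probabilities -/

section UnifProb

variable {Ω : Type*} [Finite Ω]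

theorem unifProb_le_one (E : Ω → Prop) : unifProb E ≤ 1 := by
  unfold unifProb
  apply div_le_one_of_le₀ _ (by positivity)
  exact_mod_cast Finite.card_subtype_le E

theorem unifProb_mono {E F : Ω → Prop} (h : ∀ ω, E ω → F ω) : unifProb E ≤ unifProb F := by
  unfold unifProb
  gcongr
  exact Nat.card_le_card_of_injective (Subtype.map id h)
    (Subtype.map_injective h Function.injective_id)

theorem unifProb_exists_le {ι : Type*} (s : Finset ι) (E : ι → Ω → Prop) :
    unifProb (fun ω => ∃ i ∈ s, E i ω) ≤ ∑ i ∈ s, unifProb (E i) := by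
  have := Fintype.ofFinite Ω
  unfold unifProb
  rw [← Finset.sum_div]
  gcongr
  simp only [Nat.card_eq_fintype_card, Fintype.card_subtype]
  norm_cast
  refine le_trans (card_le_card (t := s.biUnion fun i => univ.filter (E i)) ?_) card_biUnion_le
  intro ω
  simp

theorem unifProb_or_le (E F : Ω → Prop) :
    unifProb (fun ω => E ω ∨ F ω) ≤ unifProb E + unifProb F := by
  have := unifProb_exists_le (univ : Finset Bool) (fun b => if b then F else E)
  simpa [add_comm] using this

end UnifProb

/-! ### Marginals of independent families -/

section Independence

variable {U : Type*} {r κ : ℕ} {H : Finset (U → Fin r)}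

/-- In a `κ`-wise independent family, the values at any *at most* `κ` keys are uniform: for
exactly `κ` keys this is the definition, and a smaller set of keys is enlarged one key at a time,
summing over the values of the additional key. This needs a universe of at least `κ` keys. -/
theorem KWiseIndependent.card_mul_pow [Finite U] (hH : KWiseIndependent κ H)
    (hU : κ ≤ Nat.card U) (A : Finset U) (hA : A.card ≤ κ) (a : U → Fin r) :
    (H.filter fun h => ∀ x ∈ A, h x = a x).card * r ^ A.card = H.card := by
  obtain ⟨d, hd⟩ := Nat.exists_eq_add_of_le hA
  induction d generalizing A a with
  | zero =>
    have hc : A.card = κ := by omega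
    have hr : (r : ℝ) ^ κ ≠ 0 := by
      rcases A.eq_empty_or_nonempty with h | ⟨x, _⟩
      · have : κ = 0 := by simpa [h] using hc.symm
        exact this ▸ (pow_zero (r : ℝ)).symm ▸ one_ne_zero
      · have := Fin.pos (a x)
        positivity
    let e := A.equivFinOfCardEq hc
    have h1 := hH.2 (fun i => (e.symm i : U))
      (fun i j hij => e.symm.injective (Subtype.ext hij)) (fun i => a (e.symm i))
    have hH0 : ((H.card : ℕ) : ℝ) ≠ 0 := by exact_mod_cast hH.1.card_pos.ne'
    have h2 : Nat.card {h : ↥H // ∀ i, (h : U → Fin r) (e.symm i) = a (e.symm i)}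
        = (H.filter fun h => ∀ x ∈ A, h x = a x).card := by
      rw [← Nat.card_eq_finsetCard]
      refine Nat.card_congr ⟨fun h => ⟨h.1.1, mem_filter.2 ⟨h.1.2, fun x hx => ?_⟩⟩,
        fun h => ⟨⟨h.1, (mem_filter.1 h.2).1⟩, fun i => (mem_filter.1 h.2).2 _ (e.symm i).2⟩,
        fun _ => rfl, fun _ => rfl⟩
      have := h.2 (e ⟨x, hx⟩)
      simpa using this
    rw [unifProb, h2, Nat.card_eq_fintype_card, Fintype.card_coe,
      div_eq_div_iff hH0 hr] at h1
    rw [hc]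
    rw [one_mul] at h1
    exact_mod_cast h1
  | succ d ih =>
    have hlt : A.card < Nat.card U := by omega
    obtain ⟨x, hx⟩ : ∃ x, x ∉ A := by
      by_contra! h
      have h1 := Nat.card_le_card_of_injective (fun x : U => (⟨x, h x⟩ : ↥A))
        fun x y hxy => congrArg Subtype.val hxy
      rw [Nat.card_eq_finsetCard] at h1
      omega
    have hr : 0 < r := Fin.pos (a x)
    have h1 : (H.filter fun h => ∀ y ∈ A, h y = a y).card
        = ∑ j : Fin r, (H.filter fun h => ∀ y ∈ insert x A,
            h y = Function.update a x j y).card := by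
      rw [card_eq_sum_card_fiberwise (f := fun h => h x) (t := univ) (by simp)]
      refine sum_congr rfl fun j _ => congrArg card ?_
      ext h
      simp only [mem_filter, mem_insert, forall_eq_or_imp, Function.update_self]
      have : ∀ y ∈ A, Function.update a x j y = a y := fun y hy =>
        Function.update_of_ne (ne_of_mem_of_not_mem hy hx) _ _
      constructor
      · rintro ⟨⟨h1, h2⟩, h3⟩
        exact ⟨h1, h3, fun y hy => by rw [this y hy, h2 y hy]⟩
      · rintro ⟨h1, h3, h2⟩
        exact ⟨⟨h1, fun y hy => by rw [← this y hy, h2 y hy]⟩, h3⟩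
    have h2 : ∀ j, (H.filter fun h => ∀ y ∈ insert x A,
            h y = Function.update a x j y).card * r ^ (A.card + 1) = H.card := fun j => by
      have := ih (insert x A) (by rw [card_insert_of_notMem hx]; omega) (Function.update a x j)
        (by rw [card_insert_of_notMem hx]; omega)
      rwa [card_insert_of_notMem hx] at this
    have h3 : (H.filter fun h => ∀ y ∈ A, h y = a y).card * r ^ A.card * r = H.card * r := by
      rw [mul_assoc, ← pow_succ, h1, sum_mul, sum_congr rfl fun j _ => h2 j]
      simp [mul_comm]
    exact Nat.eq_of_mul_eq_mul_right hr h3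

end Independence

/-! ### Collisions under an independent family -/

section Collisions

variable {U : Type*} {l k : ℕ} {Hl : Finset (U → Fin l)}

/-- `k` prescribed pairs `(y i, w i)` of keys, where the `y i` are distinct and differ from all
`w i`, all collide with probability at most `l⁻ᵏ`: once the values on the `w i` are fixed, those
on the `y i` are determined, and at most `2 k` keys are involved. -/
theorem card_collisions_mul_le [Finite U] (hH : KWiseIndependent (2 * k) Hl)
    (hU : 2 * k ≤ Nat.card U) (hl : 0 < l) (y w : Fin k → U) (hy : Function.Injective y)
    (hyw : ∀ i j, w i ≠ y j) :
    (Hl.filter fun g => ∀ i, g (y i) = g (w i)).card * l ^ k ≤ Hl.card := by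
  set W := univ.image w with hW
  set Y := univ.image y with hY
  have hdis : Disjoint W Y := by
    rw [disjoint_left]
    intro x hx hx'
    simp only [hW, hY, mem_image, mem_univ, true_and] at hx hx'
    obtain ⟨i, rfl⟩ := hx
    obtain ⟨j, hj⟩ := hx'
    exact hyw i j hj.symm
  have hYc : Y.card = k := by simp [hY, card_image_of_injective _ hy]
  have hWc : W.card ≤ k := by simpa [hW] using card_image_le (s := univ) (f := w)
  have hc : (W ∪ Y).card = W.card + k := by rw [card_union_of_disjoint hdis, hYc]
  have key : ∀ b : ↥W → Fin l,
      ((Hl.filter fun g => ∀ i, g (y i) = g (w i)).filter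
        fun g => (fun x : ↥W => g x) = b).card * l ^ (W.card + k) ≤ Hl.card := by
    intro b
    rcases ((Hl.filter fun g => ∀ i, g (y i) = g (w i)).filter
        fun g => (fun x : ↥W => g x) = b).eq_empty_or_nonempty with h | ⟨g₀, hg₀⟩
    · simp [h]
    · rw [← hH.card_mul_pow hU (W ∪ Y) (by omega) g₀, hc]
      gcongr ?_ * _
      refine card_le_card fun g hg => ?_
      simp only [mem_filter] at hg hg₀ ⊢
      have hWg : ∀ x ∈ W, g x = g₀ x := fun x hx =>
        congrFun (hg.2.trans hg₀.2.symm) ⟨x, hx⟩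
      refine ⟨hg.1.1, fun x hx => ?_⟩
      rcases mem_union.1 hx with hx | hx
      · exact hWg x hx
      · obtain ⟨i, -, rfl⟩ := mem_image.1 hx
        rw [hg.1.2, hg₀.1.2, hWg _ (by simp [hW])]
  have h1 : (Hl.filter fun g => ∀ i, g (y i) = g (w i)).card * l ^ k * l ^ W.card
      ≤ Hl.card * l ^ W.card := by
    rw [mul_assoc, ← pow_add, add_comm k,
      card_eq_sum_card_fiberwise (f := fun g => fun x : ↥W => g x) (t := univ) (by simp), sum_mul]
    refine (sum_le_sum fun b _ => key b).trans ?_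
    simp [mul_comm]
  exact Nat.le_of_mul_le_mul_right h1 (by positivity)

/-- A function that shrinks `T` by at least `k` has `k` collisions: a key `y i` outside a fixed
system of representatives of the fibres, and the representative of its fibre, for `k` different
`y i`. The union bound over these `2 k` keys gives the estimate. -/
theorem card_shrink_mul_le [Finite U] (hH : KWiseIndependent (2 * k) Hl)
    (hU : 2 * k ≤ Nat.card U) (hl : 0 < l) (T : Finset U) :
    (Hl.filter fun g => (T.image g).card + k ≤ T.card).card * l ^ k
      ≤ (T.card ^ 2) ^ k * Hl.card := by
  have hsub : (Hl.filter fun g => (T.image g).card + k ≤ T.card) ⊆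
      ((Fintype.piFinset fun _ : Fin k => T ×ˢ T).filter fun q =>
        (Function.Injective fun i => (q i).1) ∧ ∀ i j, (q i).2 ≠ (q j).1).biUnion
          fun q => Hl.filter fun g => ∀ i, g (q i).1 = g (q i).2 := by
    intro g hg
    obtain ⟨hgH, hg⟩ := mem_filter.1 hg
    rcases T.eq_empty_or_nonempty with rfl | ⟨x₀, -⟩
    · obtain rfl : k = 0 := by simpa using hg
      simp [hgH, Function.injective_of_subsingleton]
    have : Nonempty U := ⟨x₀⟩
    have hex : ∀ v ∈ T.image g, ∃ x ∈ T, g x = v := fun v hv => by simpa using hv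
    choose! ρ hρT hρ using hex
    have hcard : k ≤ (T \ (T.image g).image ρ).card := by
      have := le_card_sdiff ((T.image g).image ρ) T
      have := card_image_le (s := T.image g) (f := ρ)
      omega
    obtain ⟨Y, hY, hYc⟩ := exists_subset_card_eq hcard
    let e := (Y.equivFinOfCardEq hYc).symm
    have heT : ∀ i, (e i : U) ∈ T := fun i => (mem_sdiff.1 (hY (e i).2)).1
    refine mem_biUnion.2 ⟨fun i => ((e i : U), ρ (g (e i))), ?_, ?_⟩
    · simp only [mem_filter, Fintype.mem_piFinset, mem_product]
      refine ⟨fun i => ⟨heT i, hρT _ (mem_image_of_mem _ (heT i))⟩,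
        fun i j hij => e.injective (Subtype.ext hij), fun i j hij => ?_⟩
      refine (mem_sdiff.1 (hY (e j).2)).2 ?_
      rw [← hij]
      exact mem_image_of_mem _ (mem_image_of_mem _ (heT i))
    · simp only [mem_filter]
      exact ⟨hgH, fun i => (hρ _ (mem_image_of_mem _ (heT i))).symm⟩
  calc _ ≤ (∑ q ∈ (Fintype.piFinset fun _ : Fin k => T ×ˢ T).filter fun q =>
        (Function.Injective fun i => (q i).1) ∧ ∀ i j, (q i).2 ≠ (q j).1,
          (Hl.filter fun g => ∀ i, g (q i).1 = g (q i).2).card) * l ^ k := by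
        gcongr ?_ * _
        exact (card_le_card hsub).trans card_biUnion_le
    _ ≤ ∑ q ∈ (Fintype.piFinset fun _ : Fin k => T ×ˢ T).filter fun q =>
        (Function.Injective fun i => (q i).1) ∧ ∀ i j, (q i).2 ≠ (q j).1, Hl.card := by
        rw [sum_mul]
        refine sum_le_sum fun q hq => ?_
        obtain ⟨-, h1, h2⟩ := mem_filter.1 hq
        exact card_collisions_mul_le hH hU hl _ _ h1 h2
    _ ≤ _ := by
        rw [sum_const, smul_eq_mul]
        gcongr
        refine (card_filter_le _ _).trans ?_
        simp [Fintype.card_piFinset, sq]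

end Collisions

/-! ### Uniformity of the hash functions on a set of keys -/

section Uniformity

variable {U : Type*} {m l c k : ℕ} {Hm : Finset (U → Fin m)}

/-- The components `(f, z)` for which the hash function takes prescribed values on `T`, the
functions `g` being fixed. -/
def matching (Hm : Finset (U → Fin m)) (g : Fin c → U → Fin l) (T : Finset U) (a : U → Fin m) :
    Finset ((U → Fin m) × (Fin c → Fin l → Fin m)) :=
  (Hm ×ˢ univ).filter fun q => ∀ x ∈ T, hashFun q.1 g q.2 x = a x

/-- If the key `x` does not share its `g j`-cell with a key of `T`, then the entry of that cell
in the `j`-th table can be changed freely without affecting `T`, while only one of the `m`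
entries gives the prescribed value on `x`. -/
theorem card_matching_insert_mul_le (g : Fin c → U → Fin l) (a : U → Fin m) (T : Finset U)
    (x : U) (j : Fin c) (hx : ∀ y ∈ T, g j y ≠ g j x) :
    (matching Hm g (insert x T) a).card * m ≤ (matching Hm g T a).card := by
  have h := card_le_card_of_injOn (s := matching Hm g (insert x T) a ×ˢ (univ : Finset (Fin m)))
    (t := matching Hm g T a)
    (fun q => (q.1.1, Function.update q.1.2 j (Function.update (q.1.2 j) (g j x) q.2))) ?_ ?_
  · simpa using h
  · rintro ⟨⟨f, z⟩, b⟩ hq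
    simp only [matching, coe_product, coe_filter, Set.mem_prod, Set.mem_ofPred_eq, mem_product,
      mem_univ, and_true, mem_insert, forall_eq_or_imp] at hq ⊢
    refine ⟨hq.1.1, fun y hy => ?_⟩
    rw [← hq.1.2.2 y hy]
    simp only [hashFun, Fin.mk.injEq]
    congr 2
    refine sum_congr rfl fun i _ => ?_
    by_cases hi : i = j
    · subst hi
      simp [Function.update_of_ne (hx y hy)]
    · simp [Function.update_of_ne hi]
  · rintro ⟨⟨f, z⟩, b⟩ hq ⟨⟨f', z'⟩, b'⟩ hq' heq
    simp only [matching, coe_product, coe_filter, Set.mem_prod, Set.mem_ofPred_eq, mem_product,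
      mem_univ, and_true, mem_insert, forall_eq_or_imp] at hq hq'
    simp only [Prod.mk.injEq] at heq
    obtain ⟨rfl, hz⟩ := heq
    have hb : b = b' := by
      have := congrFun (congrFun hz j) (g j x)
      simpa using this
    have hne : ∀ i v, (i ≠ j ∨ v ≠ g j x) → z i v = z' i v := by
      intro i v hiv
      have := congrFun (congrFun hz i) v
      by_cases hi : i = j
      · subst hi
        simpa [Function.update_of_ne (hiv.resolve_left (not_not.2 rfl))] using this
      · simpa [Function.update_of_ne hi] using this
    have hent : z j (g j x) = z' j (g j x) := by
      have h1 := hq.1.2.1.trans hq'.1.2.1.symm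
      simp only [hashFun, Fin.mk.injEq] at h1
      rw [← add_sum_erase _ _ (mem_univ j), ← add_sum_erase univ (fun j => (z' j (g j x) : ℕ))
        (mem_univ j), sum_congr rfl (g := fun j => (z' j (g j x) : ℕ))
        (fun i hi => by rw [hne i _ (Or.inl (ne_of_mem_erase hi))])] at h1
      have h2 : (z j (g j x) : ℕ) ≡ z' j (g j x) [MOD m] :=
        Nat.ModEq.add_right_cancel' _ (Nat.ModEq.add_left_cancel' _ h1)
      exact Fin.ext (Nat.ModEq.eq_of_lt_of_lt h2 (Fin.is_lt _) (Fin.is_lt _))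
    have : z = z' := by
      funext i v
      by_cases hiv : i ≠ j ∨ v ≠ g j x
      · exact hne i v hiv
      · push Not at hiv
        rw [hiv.1, hiv.2, hent]
    rw [this, hb]

theorem card_matching_union_mul_le (g : Fin c → U → Fin l) (a : U → Fin m) (D N : Finset U)
    (j : Fin c) (hN : ∀ x ∈ N, ∀ y ∈ D ∪ N, y ≠ x → g j y ≠ g j x) (hDN : Disjoint D N) :
    (matching Hm g (D ∪ N) a).card * m ^ N.card ≤ (matching Hm g D a).card := by
  induction N using Finset.induction_on with
  | empty => simp
  | insert x N hx ih =>
    rw [disjoint_insert_right] at hDN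
    rw [card_insert_of_notMem hx, union_insert]
    have h1 := card_matching_insert_mul_le (Hm := Hm) g a (D ∪ N) x j fun y hy =>
      hN x (mem_insert_self _ _) y (by simp at hy ⊢; tauto) fun h => by
        subst h
        rcases mem_union.1 hy with hy | hy
        · exact hDN.1 hy
        · exact hx hy
    have h2 := ih (fun y hy z hz => hN y (mem_insert_of_mem hy) z (by simp at hz ⊢; tauto)) hDN.2
    calc _ = ((matching Hm g (insert x (D ∪ N)) a).card * m) * m ^ N.card := by ring
      _ ≤ _ := (Nat.mul_le_mul_right _ h1).trans h2

/-- On at most `2 k` keys the function `f` alone makes the hash function uniform, for any tables.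
-/
theorem card_matching_small_mul_le [Finite U] (hH : KWiseIndependent (2 * k) Hm)
    (hU : 2 * k ≤ Nat.card U) (g : Fin c → U → Fin l) (a : U → Fin m) (D : Finset U)
    (hD : D.card ≤ 2 * k) :
    (matching Hm g D a).card * m ^ D.card ≤ Hm.card * (m ^ l) ^ c := by
  have key : ∀ z : Fin c → Fin l → Fin m,
      ((matching Hm g D a).filter fun q => q.2 = z).card * m ^ D.card ≤ Hm.card := by
    intro z
    rcases ((matching Hm g D a).filter fun q => q.2 = z).eq_empty_or_nonempty
      with h | ⟨⟨f₀, z₀⟩, h₀⟩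
    · simp [h]
    · simp only [matching, mem_filter, mem_product, mem_univ, and_true] at h₀
      obtain ⟨⟨hf₀, h₀⟩, rfl⟩ := h₀
      rw [← hH.card_mul_pow hU D hD f₀]
      gcongr ?_ * _
      refine card_le_card_of_injOn Prod.fst ?_ ?_
      · rintro ⟨f, z⟩ hq
        simp only [matching, coe_filter, mem_filter, mem_product, mem_univ, and_true,
          Set.mem_ofPred_eq] at hq ⊢
        obtain ⟨⟨hf, hq⟩, rfl⟩ := hq
        refine ⟨hf, fun x hx => ?_⟩
        have h1 := (hq x hx).trans (h₀ x hx).symm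
        simp only [hashFun, Fin.mk.injEq] at h1
        have h2 : (f x : ℕ) ≡ f₀ x [MOD m] := Nat.ModEq.add_right_cancel' _ h1
        exact Fin.ext (Nat.ModEq.eq_of_lt_of_lt h2 (Fin.is_lt _) (Fin.is_lt _))
      · rintro ⟨f, z⟩ hq ⟨f', z'⟩ hq' (rfl : f = f')
        simp only [coe_filter, Set.mem_ofPred_eq] at hq hq'
        rw [hq.2, hq'.2]
  rw [card_eq_sum_card_fiberwise (f := Prod.snd) (t := univ) (by simp), sum_mul]
  refine (sum_le_sum fun z _ => key z).trans ?_
  simp [mul_comm]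

/-- If some `g j` shrinks `T` by at most `k`, then the hash function is uniform on `T`: at most
`2 k` keys of `T` share their `g j`-cell with another key of `T`, so that `f` is uniform on them,
and each other key has a table entry of its own. -/
theorem card_matching_mul_le [Finite U] (hH : KWiseIndependent (2 * k) Hm)
    (hU : 2 * k ≤ Nat.card U) (g : Fin c → U → Fin l) (a : U → Fin m) (T : Finset U) (j : Fin c)
    (hT : T.card ≤ (T.image (g j)).card + k) :
    (matching Hm g T a).card * m ^ T.card ≤ Hm.card * (m ^ l) ^ c := by
  set D := T.filter fun x => ∃ y ∈ T, y ≠ x ∧ g j y = g j x with hDdef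
  set N := T.filter fun x => ¬ ∃ y ∈ T, y ≠ x ∧ g j y = g j x with hNdef
  have hDN : Disjoint D N := disjoint_filter_filter_not _ _ _
  have hU' : D ∪ N = T := filter_union_filter_not_eq _ _
  have hcard : D.card + N.card = T.card := by rw [← card_union_of_disjoint hDN, hU']
  have hD : D.card ≤ 2 * k := by
    have h1 : (T.image (g j)).card ≤ (D.image (g j)).card + N.card := by
      rw [← hU', image_union]
      exact (card_union_le _ _).trans (by gcongr; exact card_image_le)
    have h2 : 2 * (D.image (g j)).card ≤ D.card := by
      refine mul_card_image_le_card D 2 fun v hv => ?_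
      obtain ⟨x, hx, rfl⟩ := mem_image.1 hv
      obtain ⟨hxT, y, hy, hyx, hxy⟩ := mem_filter.1 hx
      refine one_lt_card.2 ⟨x, mem_filter.2 ⟨hx, rfl⟩, y, ?_, hyx.symm⟩
      exact mem_filter.2 ⟨mem_filter.2 ⟨hy, x, hxT, hyx.symm, hxy.symm⟩, hxy⟩
    omega
  have h1 := card_matching_union_mul_le (Hm := Hm) g a D N j (fun x hx y hy hyx h => by
    rw [hU'] at hy
    exact (mem_filter.1 hx).2 ⟨y, hy, hyx, h⟩) hDN
  rw [hU'] at h1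
  calc _ = (matching Hm g T a).card * m ^ N.card * m ^ D.card := by rw [← hcard]; ring
    _ ≤ (matching Hm g D a).card * m ^ D.card := Nat.mul_le_mul_right _ h1
    _ ≤ _ := card_matching_small_mul_le hH hU g a D hD

end Uniformity

/-! ### Probabilities for random pairs of hash functions -/

section Family

variable {U : Type*} {m l c k : ℕ} {Hm : Finset (U → Fin m)} {Hl : Finset (U → Fin l)}

theorem ZFamily.card_eq : Nat.card (ZFamily Hm Hl c)
    = Hl.card ^ c * (Hm.card * (m ^ l) ^ c) ^ 2 := by
  rw [Nat.card_congr ZFamily.equivProd]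
  simp only [Nat.card_prod]
  simp only [Nat.card_eq_fintype_card, Fintype.card_coe, Fintype.card_pi, Fintype.card_fin,
    prod_const, card_univ]
  ring

/-- If the event `Q` on the functions `g₁, …, g_c` guarantees that one of them shrinks `T` by at
most `k`, then the pair of hash functions is uniform on `T`, conditioned on `Q`. -/
theorem unifProb_matching_le [Finite U] (hHm : KWiseIndependent (2 * k) Hm)
    (hHl : Hl.Nonempty) (hU : 2 * k ≤ Nat.card U) (hm : 0 < m) (T : Finset U)
    (Q : (Fin c → ↥Hl) → Prop)
    (hQ : ∀ g, Q g → ∃ j, T.card ≤ (T.image (g j : U → Fin l)).card + k) (a b : U → Fin m) :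
    unifProb (fun ω : ZFamily Hm Hl c => Q ω.g ∧ ∀ x ∈ T, ω.h₁ x = a x ∧ ω.h₂ x = b x)
      ≤ unifProb Q / (m : ℝ) ^ (2 * T.card) := by
  have hcount : Nat.card {ω : ZFamily Hm Hl c //
        Q ω.g ∧ ∀ x ∈ T, ω.h₁ x = a x ∧ ω.h₂ x = b x} * m ^ (2 * T.card)
      ≤ Nat.card {g // Q g} * (Hm.card * (m ^ l) ^ c) ^ 2 := by
    let g' : (Fin c → ↥Hl) → Fin c → U → Fin l := fun g j => g j
    let F : Finset (Σ _ : Fin c → ↥Hl, ((U → Fin m) × (Fin c → Fin l → Fin m)) ×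
        ((U → Fin m) × (Fin c → Fin l → Fin m))) :=
      (univ.filter Q).sigma fun g => matching Hm (g' g) T a ×ˢ matching Hm (g' g) T b
    have h1 : Nat.card {ω : ZFamily Hm Hl c //
        Q ω.g ∧ ∀ x ∈ T, ω.h₁ x = a x ∧ ω.h₂ x = b x} ≤ F.card := by
      rw [← Nat.card_eq_finsetCard]
      refine Nat.card_le_card_of_injective
        (fun ω => ⟨⟨ω.1.g, (ω.1.f₁, ω.1.z₁), (ω.1.f₂, ω.1.z₂)⟩, ?_⟩) ?_
      · simp only [F, matching, mem_sigma, mem_filter, mem_univ, true_and, mem_product, and_true,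
          coe_mem]
        exact ⟨ω.2.1, fun x hx => (ω.2.2 x hx).1, fun x hx => (ω.2.2 x hx).2⟩
      · rintro ⟨⟨f₁, f₂, g, z₁, z₂⟩, _⟩ ⟨⟨f₁', f₂', g', z₁', z₂'⟩, _⟩ h
        simp only [Subtype.mk.injEq, Sigma.mk.injEq, heq_eq_eq, Prod.mk.injEq, SetLike.coe_eq_coe]
          at h
        obtain ⟨rfl, ⟨rfl, rfl⟩, rfl, rfl⟩ := h
        rfl
    refine (Nat.mul_le_mul_right _ h1).trans ?_
    rw [card_sigma, sum_mul]
    have h2 : ∀ g ∈ univ.filter Q,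
        (matching Hm (g' g) T a ×ˢ matching Hm (g' g) T b).card * m ^ (2 * T.card)
          ≤ (Hm.card * (m ^ l) ^ c) ^ 2 := by
      intro g hg
      obtain ⟨j, hj⟩ := hQ g (mem_filter.1 hg).2
      rw [card_product, two_mul, pow_add, mul_mul_mul_comm, sq]
      exact Nat.mul_le_mul (card_matching_mul_le hHm hU (g' g) a T j hj)
        (card_matching_mul_le hHm hU (g' g) b T j hj)
    refine (sum_le_sum h2).trans ?_
    rw [sum_const, smul_eq_mul, Nat.card_eq_fintype_card, Fintype.card_subtype]
  have hpos : 0 < (Hm.card * (m ^ l) ^ c) ^ 2 := by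
    have := hHm.1.card_pos
    positivity
  have hpos' : 0 < Hl.card ^ c := by
    have := hHl.card_pos
    positivity
  unfold unifProb
  rw [ZFamily.card_eq, Nat.card_eq_fintype_card (α := Fin c → ↥Hl), Fintype.card_pi, prod_const,
    Fintype.card_coe, card_univ, Fintype.card_fin, div_div, div_le_div_iff₀ (by positivity)
    (by positivity)]
  norm_cast
  calc _ = Nat.card {ω : ZFamily Hm Hl c //
        Q ω.g ∧ ∀ x ∈ T, ω.h₁ x = a x ∧ ω.h₂ x = b x} * m ^ (2 * T.card) * Hl.card ^ c := by ring
    _ ≤ _ := Nat.mul_le_mul_right _ hcount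
    _ = _ := by ring

theorem unifProb_shrink_le [Finite U] (hHl : KWiseIndependent (2 * k) Hl)
    (hU : 2 * k ≤ Nat.card U) (hl : 0 < l) (T : Finset U) :
    unifProb (fun g : Fin c → ↥Hl => ∀ j, (T.image (g j : U → Fin l)).card + k ≤ T.card)
      ≤ ((T.card : ℝ) ^ 2 / l) ^ (k * c) := by
  have hcard : Nat.card {g : Fin c → ↥Hl //
        ∀ j, (T.image (g j : U → Fin l)).card + k ≤ T.card}
      = (Hl.filter fun g => (T.image g).card + k ≤ T.card).card ^ c := by
    have e : {g : Fin c → ↥Hl // ∀ j, (T.image (g j : U → Fin l)).card + k ≤ T.card} ≃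
        (Fin c → ↥(Hl.filter fun g => (T.image g).card + k ≤ T.card)) :=
      ⟨fun g j => ⟨g.1 j, mem_filter.2 ⟨(g.1 j).2, g.2 j⟩⟩,
        fun g => ⟨fun j => ⟨g j, (mem_filter.1 (g j).2).1⟩, fun j => (mem_filter.1 (g j).2).2⟩,
        fun _ => rfl, fun _ => rfl⟩
    rw [Nat.card_congr e, Nat.card_eq_fintype_card, Fintype.card_pi, prod_const,
      Fintype.card_coe, card_univ, Fintype.card_fin]
  have hpos := hHl.1.card_pos
  unfold unifProb
  rw [hcard, Nat.card_eq_fintype_card, Fintype.card_pi, prod_const,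
    Fintype.card_coe, card_univ, Fintype.card_fin, pow_mul, Nat.cast_pow, Nat.cast_pow, ← div_pow]
  gcongr
  rw [div_pow, div_le_div_iff₀ (by positivity) (by positivity)]
  exact_mod_cast card_shrink_mul_le hHl hU hl T

end Family

/-! ### Counting explored edge lists -/

section Exploration

variable {m : ℕ}

/-- The edge between the node `w` and the node number `i` of the other side. -/
def edgeAt : Fin m ⊕ Fin m → Fin m → Fin m × Fin m
  | .inl a, i => (a, i)
  | .inr b, i => (i, b)

/-- The node number `i` of the side on which `w` does not lie. -/
def across : Fin m ⊕ Fin m → Fin m → Fin m ⊕ Fin m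
  | .inl _, i => .inr i
  | .inr _, i => .inl i

/-- The number of a node within its side. -/
def label : Fin m ⊕ Fin m → Fin m := Sum.elim id id

@[simp] theorem label_across (w : Fin m ⊕ Fin m) (i : Fin m) : label (across w i) = i := by
  cases w <;> rfl

/-- The end points of a list of edges. -/
def ends (E : List (Fin m × Fin m)) : List (Fin m ⊕ Fin m) :=
  E.flatMap fun e => [.inl e.1, .inr e.2]

theorem length_ends (E : List (Fin m × Fin m)) : (ends E).length = 2 * E.length := by
  induction E with
  | nil => rfl
  | cons e E ih => simp [ends] at ih ⊢; omega

/-- `Explored E w r v`: the edge list `E` (latest edge first) arises by following trails. The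
current end of the trail is `w` (`none` if there is no current trail), `v` is the number of free
choices of a node, and `r` is the number of exceptional moves, i.e. of all moves but `extend`.
A trail begins at an arbitrary node (`start`) or at an end point of an earlier edge (`jump`), is
prolonged by edges to arbitrary nodes (`extend`) and finished by an edge to an end point of an
earlier edge (`close`). The side condition of `start` ensures that there are never more than
`E.length + 1` free choices. -/
inductive Explored : List (Fin m × Fin m) → Option (Fin m ⊕ Fin m) → ℕ → ℕ → Prop
  | nil : Explored [] none 0 0
  | start {E w r v} (u : Fin m ⊕ Fin m) : Explored E w r v → v ≤ E.length →
      Explored E (some u) (r + 1) (v + 1)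
  | jump {E w r v} (u : Fin m ⊕ Fin m) : Explored E w r v → u ∈ ends E →
      Explored E (some u) (r + 1) v
  | extend {E w r v} (i : Fin m) : Explored E (some w) r v →
      Explored (edgeAt w i :: E) (some (across w i)) r (v + 1)
  | close {E w r v} (i : Fin m) : Explored E (some w) r v → across w i ∈ ends E →
      Explored (edgeAt w i :: E) none (r + 1) v

theorem Explored.le_length {E : List (Fin m × Fin m)} {w : Option (Fin m ⊕ Fin m)} {r v : ℕ}
    (h : Explored E w r v) : v ≤ E.length + 1 := by
  induction h <;> grind [List.length_cons]

theorem Explored.tail {E : List (Fin m × Fin m)} {w : Option (Fin m ⊕ Fin m)} {r v : ℕ}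
    (h : Explored E w r v) : ∃ w' r' v', r' ≤ r ∧ Explored E.tail w' r' v' := by
  induction h with
  | nil => exact ⟨none, 0, 0, le_rfl, .nil⟩
  | start u h hv ih =>
    obtain ⟨w', r', v', hr, h'⟩ := ih
    exact ⟨w', r', v', by omega, h'⟩
  | jump u h hv ih =>
    obtain ⟨w', r', v', hr, h'⟩ := ih
    exact ⟨w', r', v', by omega, h'⟩
  | extend i h ih => exact ⟨_, _, _, le_rfl, h⟩
  | close i h hi ih => exact ⟨_, _, _, by omega, h⟩

/-- What has been explored earlier is a final segment, as the latest edge comes first. -/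
theorem Explored.suffix {E E' : List (Fin m × Fin m)} {w : Option (Fin m ⊕ Fin m)} {r v : ℕ}
    (h : Explored E w r v) (hE : E' <:+ E) : ∃ w' r' v', r' ≤ r ∧ Explored E' w' r' v' := by
  induction E generalizing w r v with
  | nil =>
    rw [List.suffix_nil] at hE
    exact ⟨w, r, v, le_rfl, hE ▸ h⟩
  | cons e E ih =>
    rcases List.suffix_cons_iff.1 hE with rfl | hE
    · exact ⟨w, r, v, le_rfl, h⟩
    · obtain ⟨w', r', v', hr, h'⟩ := h.tail
      obtain ⟨w'', r'', v'', hr', h''⟩ := ih h' hE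
      exact ⟨w'', r'', v'', by omega, h''⟩

/-- The explored edge lists of length `t`, with the current ends of their trails. -/
def exploredSet (m r t v : ℕ) : Set (List (Fin m × Fin m) × Option (Fin m ⊕ Fin m)) :=
  {q | q.1.length = t ∧ Explored q.1 q.2 r v}

theorem encard_le_of_forall_mem {α β : Type*} {A : Set α} {B : Set β} {a b : ℕ}
    (hA : A.encard ≤ a) (f : α → Finset β) (hf : ∀ x ∈ A, (f x).card ≤ b)
    (hB : ∀ y ∈ B, ∃ x ∈ A, y ∈ f x) : B.encard ≤ (a * b : ℕ) := by
  have hfin : A.Finite := Set.finite_of_encard_le_coe hA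
  have hsub : B ⊆ (hfin.toFinset.biUnion f : Finset β) := fun y hy => by simpa using hB y hy
  refine (Set.encard_le_encard hsub).trans ?_
  rw [Set.encard_coe_eq_coe_finsetCard]
  rw [hfin.encard_eq_coe_toFinset_card] at hA
  norm_cast at hA ⊢
  exact (card_biUnion_le_card_mul _ _ b (by simpa using hf)).trans (by gcongr)

/-- The edge lists that end with an `extend` move. -/
theorem encard_extended_le {r t v a : ℕ} (h : (exploredSet m r t v).encard ≤ a) :
    {q : List (Fin m × Fin m) × Option (Fin m ⊕ Fin m) | ∃ E w i, Explored E (some w) r v ∧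
      E.length = t ∧ q = (edgeAt w i :: E, some (across w i))}.encard ≤ (a * m : ℕ) := by
  refine encard_le_of_forall_mem h (fun q => q.2.elim ∅ fun w =>
    univ.image fun i => (edgeAt w i :: q.1, some (across w i))) ?_ ?_
  · rintro ⟨E, _ | w⟩ -
    · simp
    · exact card_image_le.trans (by simp)
  · rintro _ ⟨E, w, i, h, ht, rfl⟩
    exact ⟨(E, some w), ⟨ht, h⟩, mem_image_of_mem _ (mem_univ i)⟩

/-- The edge lists that end with a `start` move. -/
theorem encard_started_le {r t v a : ℕ} (h : (exploredSet m r t v).encard ≤ a) :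
    {q : List (Fin m × Fin m) × Option (Fin m ⊕ Fin m) | ∃ E w u, Explored E w r v ∧
      E.length = t ∧ q = (E, some u)}.encard ≤ (a * (2 * m) : ℕ) := by
  refine encard_le_of_forall_mem h (fun q => univ.image fun u => (q.1, some u)) ?_ ?_
  · rintro ⟨E, w⟩ -
    exact card_image_le.trans (by simp [two_mul])
  · rintro _ ⟨E, w, u, h, ht, rfl⟩
    exact ⟨(E, w), ⟨ht, h⟩, by simp⟩

/-- The edge lists that end with a `jump` move. -/
theorem encard_jumped_le {r t v a : ℕ} (h : (exploredSet m r t v).encard ≤ a) :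
    {q : List (Fin m × Fin m) × Option (Fin m ⊕ Fin m) | ∃ E w u, Explored E w r v ∧
      E.length = t ∧ u ∈ ends E ∧ q = (E, some u)}.encard ≤ (a * (2 * t) : ℕ) := by
  refine encard_le_of_forall_mem h
    (fun q => (ends q.1).toFinset.image fun u => (q.1, some u)) ?_ ?_
  · rintro ⟨E, w⟩ hq
    refine card_image_le.trans ((List.toFinset_card_le _).trans ?_)
    rw [length_ends, hq.1]
  · rintro _ ⟨E, w, u, h, ht, hu, rfl⟩
    exact ⟨(E, w), ⟨ht, h⟩, by simpa using hu⟩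

/-- The edge lists that end with a `close` move. -/
theorem encard_closed_le {r t v a : ℕ} (h : (exploredSet m r t v).encard ≤ a) :
    {q : List (Fin m × Fin m) × Option (Fin m ⊕ Fin m) | ∃ E w i, Explored E (some w) r v ∧
      E.length = t ∧ across w i ∈ ends E ∧ q = (edgeAt w i :: E, none)}.encard
        ≤ (a * (2 * t) : ℕ) := by
  refine encard_le_of_forall_mem h (fun q => q.2.elim ∅ fun w =>
    (ends q.1).toFinset.image fun u => (edgeAt w (label u) :: q.1, none)) ?_ ?_
  · rintro ⟨E, _ | w⟩ hq
    · simp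
    · refine card_image_le.trans ((List.toFinset_card_le _).trans ?_)
      rw [length_ends, hq.1]
  · rintro _ ⟨E, w, i, h, ht, hi, rfl⟩
    refine ⟨(E, some w), ⟨ht, h⟩, mem_image.2 ⟨across w i, by simpa using hi, by simp⟩⟩

/-- The number of explored edge lists. It satisfies
`N r t v ≤ m N r (t-1) (v-1) + 2 m N (r-1) t (v-1) + 2 t N (r-1) t v + 2 (t-1) N (r-1) (t-1) v`,
with one summand for each kind of move, and `2 t² + 2 + 2 t + 2 t = 2 (t + 1)²`. -/
theorem encard_exploredSet_le (hm : 0 < m) (r t v : ℕ) :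
    (exploredSet m r t v).encard ≤ (m ^ v * (2 * (t + 1) ^ 2) ^ r : ℕ) := by
  have hext : ∀ r t v, (∀ v, (exploredSet m r t v).encard ≤ (m ^ v * (2 * (t + 1) ^ 2) ^ r : ℕ)) →
      {q : List (Fin m × Fin m) × Option (Fin m ⊕ Fin m) | ∃ E w i v', Explored E (some w) r v' ∧
        E.length = t ∧ q = (edgeAt w i :: E, some (across w i)) ∧ v = v' + 1}.encard
      ≤ (m ^ v * (2 * (t + 1) ^ 2) ^ r : ℕ) := by
    rintro r t (_ | v) h
    · simp
    · refine le_trans (Set.encard_le_encard ?_)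
        ((encard_extended_le (h v)).trans (le_of_eq (by congr 1; ring)))
      rintro q ⟨E, w, i, v', h, ht, hq, hv⟩
      obtain rfl : v = v' := by omega
      exact ⟨E, w, i, h, ht, hq⟩
  induction r generalizing t v with
  | zero =>
    induction t generalizing v with
    | zero =>
      have : exploredSet m 0 0 v ⊆ {([], none)} := by
        rintro ⟨E, w⟩ ⟨h1, h2⟩
        simp only at h1 h2
        cases h2 <;> simp at h1 ⊢
      refine (Set.encard_le_encard this).trans ?_
      rw [Set.encard_singleton]
      norm_cast
      simpa using Nat.one_le_pow _ _ hm
    | succ t ih =>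
      refine le_trans (Set.encard_le_encard ?_) ((hext 0 t v ih).trans (by simp))
      rintro ⟨E, w⟩ ⟨h1, h2⟩
      simp only at h1 h2
      cases h2 with
      | nil => simp at h1
      | extend i h => exact ⟨_, _, _, _, h, by simpa using h1, rfl, rfl⟩
  | succ r ih =>
    have hstart : ∀ t v, {q : List (Fin m × Fin m) × Option (Fin m ⊕ Fin m) |
        ∃ E w u v', Explored E w r v' ∧ E.length = t ∧ q = (E, some u) ∧ v = v' + 1}.encard
        ≤ (m ^ v * (2 * (t + 1) ^ 2) ^ r * 2 : ℕ) := by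
      rintro t (_ | v)
      · simp
      · refine le_trans (Set.encard_le_encard ?_)
          ((encard_started_le (ih t v)).trans (le_of_eq (by congr 1; ring)))
        rintro q ⟨E, w, u, v', h, ht, hq, hv⟩
        obtain rfl : v = v' := by omega
        exact ⟨E, w, u, h, ht, hq⟩
    induction t generalizing v with
    | zero =>
      refine le_trans (Set.encard_le_encard ?_) ((hstart 0 v).trans (le_of_eq (by congr 1; ring)))
      rintro ⟨E, w⟩ ⟨h1, h2⟩
      simp only at h1 h2
      cases h2 with
      | start u h hv => exact ⟨_, _, _, _, h, h1, rfl, rfl⟩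
      | jump u h hu =>
        rw [List.length_eq_zero_iff] at h1
        simp [h1, ends] at hu
      | extend i h => simp at h1
      | close i h hi => simp at h1
    | succ t iht =>
      refine le_trans (Set.encard_le_encard (t := (_ ∪ _) ∪ (_ ∪ _)) ?_)
        ((Set.encard_union_le _ _).trans (add_le_add
          ((Set.encard_union_le _ _).trans (add_le_add (hext (r + 1) t v iht) (hstart (t + 1) v)))
          ((Set.encard_union_le _ _).trans (add_le_add (encard_jumped_le (ih (t + 1) v))
            (encard_closed_le (ih t v)))))) |>.trans ?_
      · rintro ⟨E, w⟩ ⟨h1, h2⟩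
        simp only at h1 h2
        cases h2 with
        | start u h hv => exact Or.inl (Or.inr ⟨_, _, _, _, h, h1, rfl, rfl⟩)
        | jump u h hu => exact Or.inr (Or.inl ⟨_, _, _, h, h1, hu, rfl⟩)
        | extend i h => exact Or.inl (Or.inl ⟨_, _, _, _, h, by simpa using h1, rfl, rfl⟩)
        | close i h hi => exact Or.inr (Or.inr ⟨_, _, _, h, by simpa using h1, hi, rfl⟩)
      · norm_cast
        have h1 : (2 * (t + 1) ^ 2) ^ r ≤ (2 * (t + 1 + 1) ^ 2) ^ r := by gcongr; omega
        set X := (2 * (t + 1) ^ 2) ^ r with hX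
        set Y := (2 * (t + 1 + 1) ^ 2) ^ r with hY
        have h2 : (2 * (t + 1) ^ 2) ^ (r + 1) = X * (2 * (t + 1) ^ 2) := pow_succ _ _
        have h3 : (2 * (t + 1 + 1) ^ 2) ^ (r + 1) = Y * (2 * (t + 1 + 1) ^ 2) := pow_succ _ _
        rw [h2, h3]
        calc _ = m ^ v * X * (2 * (t + 1) ^ 2 + 2 * t) + m ^ v * Y * (2 + 2 * (t + 1)) := by ring
          _ ≤ m ^ v * Y * (2 * (t + 1) ^ 2 + 2 * t) + m ^ v * Y * (2 + 2 * (t + 1)) := by gcongr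
          _ ≤ m ^ v * Y * (2 * (t + 1 + 1) ^ 2) := by
            rw [← mul_add]
            exact Nat.mul_le_mul_left _ (by nlinarith)
          _ = _ := by ring

end Exploration

/-! ### Unstorable sets contain explored lists -/

section Storage

variable {U : Type*} {m : ℕ} {h₁ h₂ : U → Fin m}

/-- `p` puts every key of `I` into one of its two cells, and no two keys into the same cell. Cells
are the nodes of the cuckoo graph. -/
structure IsStorage (h₁ h₂ : U → Fin m) (I : Finset U) (p : U → Fin m ⊕ Fin m) : Prop where
  mem : ∀ x ∈ I, p x = Sum.inl (h₁ x) ∨ p x = Sum.inr (h₂ x)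
  inj : Set.InjOn p I

/-- The cell of the key `x` other than `w`. -/
def otherCell (h₁ h₂ : U → Fin m) (x : U) (w : Fin m ⊕ Fin m) : Fin m ⊕ Fin m :=
  if w = .inl (h₁ x) then .inr (h₂ x) else .inl (h₁ x)

theorem otherCell_mem (x : U) (w : Fin m ⊕ Fin m) :
    otherCell h₁ h₂ x w = .inl (h₁ x) ∨ otherCell h₁ h₂ x w = .inr (h₂ x) := by
  unfold otherCell
  split_ifs <;> simp

/-- The cell is occupied. -/
def Occupied (I : Finset U) (p : U → Fin m ⊕ Fin m) (w : Fin m ⊕ Fin m) : Prop :=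
  ∃ x ∈ I, p x = w

/-- The other cell of the key stored in the cell `w`, and `w` itself if this cell is empty: the
next cell in the cuckoo insertion procedure. -/
def kick (h₁ h₂ : U → Fin m) (I : Finset U) (p : U → Fin m ⊕ Fin m) (w : Fin m ⊕ Fin m) :
    Fin m ⊕ Fin m :=
  if h : Occupied I p w then otherCell h₁ h₂ h.choose w else w

theorem IsStorage.kick_apply {I : Finset U} {p : U → Fin m ⊕ Fin m} (hp : IsStorage h₁ h₂ I p)
    {x : U} (hx : x ∈ I) : kick h₁ h₂ I p (p x) = otherCell h₁ h₂ x (p x) := by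
  have h : Occupied I p (p x) := ⟨x, hx, rfl⟩
  rw [kick, dif_pos h, hp.inj h.choose_spec.1 hx h.choose_spec.2]

/-- Cuckoo insertion: if the kicks beginning at the cell `u` lead to an empty cell, then all keys
on the way are moved to their other cells, which makes `u` empty. -/
theorem IsStorage.exists_vacate {I : Finset U} {p : U → Fin m ⊕ Fin m}
    (hp : IsStorage h₁ h₂ I p) (u : Fin m ⊕ Fin m)
    (hu : ∃ a, ¬ Occupied I p ((kick h₁ h₂ I p)^[a] u)) :
    ∃ p', IsStorage h₁ h₂ I p' ∧ ¬ Occupied I p' u := by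
  set o : ℕ → Fin m ⊕ Fin m := fun i => (kick h₁ h₂ I p)^[i] u with ho
  obtain ⟨a, ha, hmin⟩ : ∃ a, ¬ Occupied I p (o a) ∧ ∀ i < a, Occupied I p (o i) :=
    ⟨Nat.find hu, Nat.find_spec hu, fun i hi => not_not.1 (Nat.find_min hu hi)⟩
  have hlt : ∀ i j, i < j → j ≤ a → o i ≠ o j := by
    intro i j hij hja h
    have h1 : o (a - j + i) = o (a - j + j) := by
      simp only [ho, Function.iterate_add_apply]
      exact congrArg _ h
    rw [Nat.sub_add_cancel hja] at h1
    exact ha (h1 ▸ hmin _ (by omega))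
  have hinj : ∀ i j, i ≤ a → j ≤ a → o i = o j → i = j := by
    intro i j hi hj h
    rcases lt_trichotomy i j with h' | h' | h'
    · exact absurd h (hlt i j h' hj)
    · exact h'
    · exact absurd h.symm (hlt j i h' hi)
  have hstep : ∀ x ∈ I, ∀ i, p x = o i → otherCell h₁ h₂ x (p x) = o (i + 1) := by
    intro x hx i hi
    rw [← hp.kick_apply hx, hi]
    simp only [ho, Function.iterate_succ_apply']
  refine ⟨fun x => if ∃ i < a, p x = o i then otherCell h₁ h₂ x (p x) else p x, ⟨?_, ?_⟩, ?_⟩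
  · intro x hx
    split_ifs
    · exact otherCell_mem _ _
    · exact hp.mem x hx
  · intro x hx y hy hxy
    dsimp only at hxy
    split_ifs at hxy with h h' h'
    · obtain ⟨i, hi, hxi⟩ := h
      obtain ⟨j, hj, hyj⟩ := h'
      rw [hstep x hx i hxi, hstep y hy j hyj] at hxy
      have := hinj _ _ hi hj hxy
      obtain rfl : i = j := by omega
      exact hp.inj hx hy (hxi.trans hyj.symm)
    · obtain ⟨i, hi, hxi⟩ := h
      rw [hstep x hx i hxi] at hxy
      rcases (Nat.succ_le_of_lt hi).lt_or_eq with h | h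
      · exact absurd ⟨i + 1, h, hxy.symm⟩ h'
      · exact absurd ⟨y, hy, by rw [← hxy, ← h]⟩ ha
    · obtain ⟨i, hi, hyi⟩ := h'
      rw [hstep y hy i hyi] at hxy
      rcases (Nat.succ_le_of_lt hi).lt_or_eq with h' | h'
      · exact absurd ⟨i + 1, h', hxy⟩ h
      · exact absurd ⟨x, hx, by rw [hxy, ← h']⟩ ha
    · exact hp.inj hx hy hxy
  · rintro ⟨x, hx, hxu⟩
    dsimp only at hxu
    split_ifs at hxu with h
    · obtain ⟨i, hi, hxi⟩ := h
      rw [hstep x hx i hxi] at hxu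
      have := hinj (i + 1) 0 hi (Nat.zero_le _) hxu
      omega
    · rcases Nat.eq_zero_or_pos a with rfl | h0
      · exact ha ⟨x, hx, hxu⟩
      · exact h ⟨0, h0, hxu⟩

/-- In a largest storable part `I` of `S`, the insertion of any further key fails: the kicks
beginning at either of its cells only meet occupied cells. -/
theorem exists_isStorage_forall_occupied (S : Finset U) (h₁ h₂ : U → Fin m) :
    ∃ I p, I ⊆ S ∧ IsStorage h₁ h₂ I p ∧ ∀ y ∈ S \ I, ∀ u,
      (u = .inl (h₁ y) ∨ u = .inr (h₂ y)) → ∀ a, Occupied I p ((kick h₁ h₂ I p)^[a] u) := by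
  obtain ⟨I, hI, hmax⟩ := exists_max_image
    (S.powerset.filter fun I => ∃ p, IsStorage h₁ h₂ I p) card
    ⟨∅, mem_filter.2 ⟨by simp, fun x => .inl (h₁ x), by simp, by simp⟩⟩
  obtain ⟨hIS, p, hp⟩ := mem_filter.1 hI
  rw [mem_powerset] at hIS
  refine ⟨I, p, hIS, hp, fun y hy u hu a => ?_⟩
  by_contra hocc
  obtain ⟨hyS, hyI⟩ := mem_sdiff.1 hy
  obtain ⟨p', hp', hu'⟩ := hp.exists_vacate u ⟨a, hocc⟩
  have hne : ∀ x ∈ I, Function.update p' y u x = p' x := fun x hx =>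
    Function.update_of_ne (ne_of_mem_of_not_mem hx hyI) _ _
  have hp'' : IsStorage h₁ h₂ (insert y I) (Function.update p' y u) := by
    refine ⟨fun x hx => ?_, ?_⟩
    · rcases mem_insert.1 hx with rfl | hx
      · simpa using hu
      · rw [hne x hx]
        exact hp'.mem x hx
    · rw [coe_insert, Set.injOn_insert (by simpa using hyI)]
      refine ⟨hp'.inj.congr fun x hx => (hne x hx).symm, ?_⟩
      rintro ⟨x, hx, hxu⟩
      rw [Function.update_self, hne x hx] at hxu
      exact hu' ⟨x, hx, hxu⟩
  have := hmax (insert y I) (mem_filter.2 ⟨mem_powerset.2 (insert_subset hyS hIS), _, hp''⟩)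
  rw [card_insert_of_notMem hyI] at this
  omega

/-- The edges of the cuckoo graph that belong to a list of keys. -/
def edges (h₁ h₂ : U → Fin m) (L : List U) : List (Fin m × Fin m) :=
  L.map fun x => (h₁ x, h₂ x)

theorem mem_ends_edges {L : List U} {w : Fin m ⊕ Fin m} :
    w ∈ ends (edges h₁ h₂ L) ↔ ∃ x ∈ L, w = .inl (h₁ x) ∨ w = .inr (h₂ x) := by
  simp [ends, edges]

theorem exists_edgeAt_eq (x : U) (w : Fin m ⊕ Fin m) (hw : w = .inl (h₁ x) ∨ w = .inr (h₂ x)) :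
    ∃ i, edgeAt w i = (h₁ x, h₂ x) ∧ across w i = otherCell h₁ h₂ x w := by
  rcases hw with rfl | rfl
  · exact ⟨h₂ x, rfl, by simp [across, otherCell]⟩
  · exact ⟨h₁ x, rfl, by simp [across, otherCell]⟩

theorem otherCell_ne (x : U) (w : Fin m ⊕ Fin m)
    (hw : w = .inl (h₁ x) ∨ w = .inr (h₂ x)) :
    otherCell h₁ h₂ x w ≠ w := by
  rcases hw with rfl | rfl <;> simp [otherCell]

/-- Following the kicks from the current cell until a cell is met for the second time completes
the trail. Since all cells on the way are occupied, the trail cannot end otherwise. -/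
theorem Explored.exists_walk {I : Finset U} {p : U → Fin m ⊕ Fin m} (hp : IsStorage h₁ h₂ I p)
    {L : List U} {w : Fin m ⊕ Fin m} {r v : ℕ} (hE : Explored (edges h₁ h₂ L) (some w) r v)
    (hL : L.Nodup) (hocc : ∀ a, Occupied I p ((kick h₁ h₂ I p)^[a] w))
    (hw : ∀ x ∈ I, p x = w → x ∉ L) :
    ∃ L' v', L ⊆ L' ∧ L'.Nodup ∧ (∀ x ∈ L', x ∈ L ∨ x ∈ I) ∧ w ∈ ends (edges h₁ h₂ L') ∧
      Explored (edges h₁ h₂ L') none (r + 1) v' ∧ v' + L.length + 1 = v + L'.length := by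
  induction hn : (I.filter (· ∉ L)).card using Nat.strong_induction_on generalizing L w v with
  | _ n ih =>
    obtain ⟨x, hxI, rfl⟩ := hocc 0
    have hx := hw x hxI rfl
    have hmem := hp.mem x hxI
    obtain ⟨i, hi, hacross⟩ := exists_edgeAt_eq x _ hmem
    have hLx : (x :: L).Nodup := List.nodup_cons.2 ⟨hx, hL⟩
    have hend : p x ∈ ends (edges h₁ h₂ (x :: L)) :=
      mem_ends_edges.2 ⟨x, List.mem_cons_self, hmem⟩
    by_cases hz : otherCell h₁ h₂ x (p x) ∈ ends (edges h₁ h₂ L)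
    · refine ⟨x :: L, v, List.subset_cons_self _ _, hLx, ?_, hend, ?_, ?_⟩
      · intro y hy
        rcases List.mem_cons.1 hy with rfl | hy
        · exact Or.inr hxI
        · exact Or.inl hy
      · have := hE.close i (by rwa [hacross])
        rwa [hi] at this
      · rw [List.length_cons]; omega
    · have hE' := hE.extend i
      rw [hi, hacross] at hE'
      have hlt : (I.filter (· ∉ x :: L)).card < n := by
        rw [← hn]
        refine card_lt_card (ssubset_iff_of_subset ?_ |>.2 ⟨x, by simp [hxI, hx], by simp⟩)
        intro y
        simp +contextual
      have hocc' : ∀ a, Occupied I p ((kick h₁ h₂ I p)^[a] (otherCell h₁ h₂ x (p x))) := by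
        intro a
        rw [← hp.kick_apply hxI, ← Function.iterate_succ_apply]
        exact hocc (a + 1)
      have hw' : ∀ y ∈ I, p y = otherCell h₁ h₂ x (p x) → y ∉ x :: L := by
        intro y hy hyz hyL
        rcases List.mem_cons.1 hyL with rfl | hyL
        · exact otherCell_ne y _ hmem hyz.symm
        · exact hz (mem_ends_edges.2 ⟨y, hyL, hyz ▸ hp.mem y hy⟩)
      obtain ⟨L', v', h1, h2, h3, h4, h5, h6⟩ := ih _ hlt (L := x :: L) hE' hLx hocc' hw' rfl
      refine ⟨L', v', fun y hy => h1 (List.mem_cons_of_mem _ hy), h2, fun y hy => ?_,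
        mem_ends_edges.2 ⟨x, h1 List.mem_cons_self, hmem⟩, h5, ?_⟩
      · rcases h3 y hy with h | h
        · rcases List.mem_cons.1 h with rfl | h
          · exact Or.inr hxI
          · exact Or.inl h
        · exact Or.inr h
      · rw [List.length_cons] at h6; omega

/-- A key `y` that cannot be inserted prolongs an exploration so that the number of edges grows by
one more than the number of free nodes: first the kicks from one cell of `y` are followed, unless
this cell is known already; then the edge `y` and the kicks from its other cell form a trail both
of whose ends are known. -/
theorem Explored.exists_add_key {I : Finset U} {p : U → Fin m ⊕ Fin m}
    (hp : IsStorage h₁ h₂ I p) {L : List U} {r v : ℕ}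
    (hE : Explored (edges h₁ h₂ L) none r v) (hL : L.Nodup) (hv : v ≤ L.length) {y : U}
    (hyI : y ∉ I) (hyL : y ∉ L) (hy : ∀ u, (u = .inl (h₁ y) ∨ u = .inr (h₂ y)) →
      ∀ a, Occupied I p ((kick h₁ h₂ I p)^[a] u)) :
    ∃ L' r' v', L'.Nodup ∧ (∀ x ∈ L', x ∈ L ∨ x ∈ I ∨ x = y) ∧
      Explored (edges h₁ h₂ L') none r' v' ∧ r' ≤ r + 4 ∧ v' + 1 + L.length = v + L'.length := by
  obtain ⟨L₁, r₁, v₁, hL₁, hmem₁, hend₁, hE₁, hr₁, hv₁⟩ : ∃ L₁ r₁ v₁, L₁.Nodup ∧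
      (∀ x ∈ L₁, x ∈ L ∨ x ∈ I) ∧ Sum.inl (h₁ y) ∈ ends (edges h₁ h₂ L₁) ∧
      Explored (edges h₁ h₂ L₁) none r₁ v₁ ∧ r₁ ≤ r + 2 ∧ v₁ + L.length = v + L₁.length := by
    by_cases hend : Sum.inl (h₁ y) ∈ ends (edges h₁ h₂ L)
    · exact ⟨L, r, v, hL, fun x => Or.inl, hend, hE, by omega, rfl⟩
    · obtain ⟨L₁, v₁, -, h2, h3, h4, h5, h6⟩ := (hE.start (.inl (h₁ y))
        (by simpa [edges] using hv)).exists_walk hp hL (hy _ (Or.inl rfl)) fun x hx hxy hxL =>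
          hend (mem_ends_edges.2 ⟨x, hxL, hxy ▸ hp.mem x hx⟩)
      exact ⟨L₁, _, v₁, h2, h3, h4, h5, le_rfl, by omega⟩
  have hyL₁ : y ∉ L₁ := fun h => (hmem₁ y h).elim hyL hyI
  have hLy : (y :: L₁).Nodup := List.nodup_cons.2 ⟨hyL₁, hL₁⟩
  have hE₂ := hE₁.jump _ hend₁
  by_cases hz : Sum.inr (h₂ y) ∈ ends (edges h₁ h₂ L₁)
  · refine ⟨y :: L₁, _, v₁, hLy, ?_, hE₂.close (h₂ y) hz, by omega, by simp; omega⟩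
    intro x hx
    rcases List.mem_cons.1 hx with rfl | hx
    · exact Or.inr (Or.inr rfl)
    · exact (hmem₁ x hx).imp_right Or.inl
  · have hE₃ : Explored (edges h₁ h₂ (y :: L₁)) (some (.inr (h₂ y))) (r₁ + 1) (v₁ + 1) :=
      hE₂.extend (h₂ y)
    obtain ⟨L', v', -, h2, h3, -, h5, h6⟩ := hE₃.exists_walk hp hLy (hy _ (Or.inr rfl))
      fun x hx hxy hxL => by
        rcases List.mem_cons.1 hxL with rfl | hxL
        · exact hyI hx
        · exact hz (mem_ends_edges.2 ⟨x, hxL, hxy ▸ hp.mem x hx⟩)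
    refine ⟨L', _, v', h2, fun x hx => ?_, h5, by omega, by simp at h6; omega⟩
    rcases h3 x hx with h | h
    · rcases List.mem_cons.1 h with rfl | h
      · exact Or.inr (Or.inr rfl)
      · exact (hmem₁ x h).imp_right Or.inl
    · exact Or.inr (Or.inl h)

/-- If `S` cannot be stored with a stash of size `s`, then some keys of `S` can be explored with a
bounded number of exceptional moves and `s + 1` fewer free nodes than edges. -/
theorem exists_explored_of_not_canStore {S : Finset U} {s : ℕ} (hS : ¬ CanStore S h₁ h₂ s) :
    ∃ (L : List U) (r v : ℕ), L.Nodup ∧ (∀ x ∈ L, x ∈ S) ∧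
      Explored (edges h₁ h₂ L) none r v ∧ r ≤ 4 * (s + 1) ∧ v + (s + 1) = L.length := by
  obtain ⟨I, p, hIS, hp, hocc⟩ := exists_isStorage_forall_occupied S h₁ h₂
  have hcard : s + 1 ≤ (S \ I).card := by
    by_contra! hlt
    refine hS ⟨S \ I, sdiff_subset, by omega, p, fun x hx hxT => hp.mem x ?_, ?_⟩
    · simpa [hx] using hxT
    · exact hp.inj.mono fun x hx => by simpa [hx.1] using hx.2
  obtain ⟨Y, hY, hYc⟩ := exists_subset_card_eq hcard
  suffices ∀ Y ⊆ S \ I, ∃ (L : List U) (r v : ℕ), L.Nodup ∧ (∀ x ∈ L, x ∈ I ∨ x ∈ Y) ∧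
      Explored (edges h₁ h₂ L) none r v ∧ r ≤ 4 * Y.card ∧ v + Y.card = L.length by
    obtain ⟨L, r, v, h1, h2, h3, h4, h5⟩ := this Y hY
    rw [hYc] at h4 h5
    exact ⟨L, r, v, h1, fun x hx => (h2 x hx).elim (fun h => hIS h)
      fun h => (mem_sdiff.1 (hY h)).1, h3, h4, h5⟩
  clear hYc hY Y
  intro Y hY
  induction Y using Finset.induction_on with
  | empty => exact ⟨[], 0, 0, by simp, by simp, .nil, by simp, by simp⟩
  | insert y Y hyY ih =>
    rw [insert_subset_iff] at hY
    obtain ⟨L, r, v, h1, h2, h3, h4, h5⟩ := ih hY.2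
    have hyI := (mem_sdiff.1 hY.1).2
    obtain ⟨L', r', v', h1', h2', h3', h4', h5'⟩ := h3.exists_add_key hp h1 (by omega) hyI
      (fun h => (h2 y h).elim hyI hyY) (hocc y hY.1)
    refine ⟨L', r', v', h1', fun x hx => ?_, h3', ?_, ?_⟩
    · rcases h2' x hx with h | h | rfl
      · exact (h2 x h).imp_right fun h => mem_insert_of_mem h
      · exact Or.inl h
      · exact Or.inr (mem_insert_self _ _)
    · rw [card_insert_of_notMem hyY]; omega
    · rw [card_insert_of_notMem hyY]; omega

end Storage

/-! ### Storable sets have small excess -/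

section Excess

variable {U : Type*} {m : ℕ} {h₁ h₂ : U → Fin m} {S T : Finset U} {p : U → Fin m ⊕ Fin m}

theorem deleteEdges_cuckooGraph_isLink {x : U} {a b : Fin m ⊕ Fin m} :
    ((cuckooGraph S h₁ h₂).deleteEdges (T : Set U)).IsLink x a b ↔
      x ∈ S \ T ∧ ((a = .inl (h₁ x) ∧ b = .inr (h₂ x)) ∨ (a = .inr (h₂ x) ∧ b = .inl (h₁ x))) := by
  rw [Graph.deleteEdges_isLink, mem_sdiff]
  simp only [cuckooGraph, mem_coe]
  tauto

theorem otherCell_of_isLink {x : U} {a b : Fin m ⊕ Fin m}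
    (h : ((cuckooGraph S h₁ h₂).deleteEdges (T : Set U)).IsLink x a b) :
    otherCell h₁ h₂ x a = b ∧ otherCell h₁ h₂ x b = a := by
  rcases (deleteEdges_cuckooGraph_isLink.1 h).2 with ⟨rfl, rfl⟩ | ⟨rfl, rfl⟩ <;>
    simp [otherCell]

theorem IsStorage.eq_or_eq_of_isLink (hp : IsStorage h₁ h₂ (S \ T) p) {x : U}
    {a b : Fin m ⊕ Fin m}
    (h : ((cuckooGraph S h₁ h₂).deleteEdges (T : Set U)).IsLink x a b) : p x = a ∨ p x = b := by
  obtain ⟨hx, h⟩ := deleteEdges_cuckooGraph_isLink.1 h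
  have := hp.mem x hx
  rcases h with ⟨rfl, rfl⟩ | ⟨rfl, rfl⟩ <;> tauto

/-- The kicks beginning at two nodes of a connected component meet: each edge belongs to the key
stored at one of its end points, so that it leads from this end point to its kick. -/
theorem IsStorage.exists_iterate_eq_of_mem_component (hp : IsStorage h₁ h₂ (S \ T) p)
    {v w : Fin m ⊕ Fin m}
    (hw : w ∈ component ((cuckooGraph S h₁ h₂).deleteEdges (T : Set U)) v) :
    ∃ a b, (kick h₁ h₂ (S \ T) p)^[a] v = (kick h₁ h₂ (S \ T) p)^[b] w := by
  induction hw with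
  | refl => exact ⟨0, 0, rfl⟩
  | @tail w w' _ hadj ih =>
    obtain ⟨a, b, hab⟩ := ih
    obtain ⟨x, hx⟩ := hadj
    have hxI := (deleteEdges_cuckooGraph_isLink.1 hx).1
    obtain ⟨h1, h2⟩ := otherCell_of_isLink hx
    rcases hp.eq_or_eq_of_isLink hx with h | h
    · have hk := hp.kick_apply hxI
      rw [h, h1] at hk
      refine ⟨1 + a, b, ?_⟩
      rw [Function.iterate_add_apply, hab, ← Function.iterate_add_apply, add_comm,
        Function.iterate_succ_apply, hk]
    · have hk := hp.kick_apply hxI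
      rw [h, h2] at hk
      exact ⟨a, b + 1, by rw [Function.iterate_succ_apply, hk, hab]⟩

theorem iterate_add_one_surj {r : ℕ} (i j : Fin (r + 1)) : ∃ a, (· + 1)^[a] i = j := by
  have h : ∀ a, (((· + 1)^[a] i : Fin (r + 1)) : ℕ) = (i + a) % (r + 1) := by
    intro a
    induction a with
    | zero => simp [Nat.mod_eq_of_lt i.2]
    | succ a ih =>
      rw [Function.iterate_succ_apply', Fin.val_add, ih, Fin.val_one', ← Nat.add_mod, add_assoc]
  refine ⟨r + 1 - i + j, Fin.ext ?_⟩
  rw [h, show (i : ℕ) + (r + 1 - i + j) = j + (r + 1) by omega, Nat.add_mod_right,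
    Nat.mod_eq_of_lt j.2]

/-- The keys of a cycle are stored in the nodes of the cycle, one in each node, and the kicks
traverse the whole cycle, in one of the two directions. -/
theorem IsStorage.cycle_spec (hp : IsStorage h₁ h₂ (S \ T) p) {r : ℕ}
    {v : Fin (r + 1) → Fin m ⊕ Fin m} {e : Fin (r + 1) → U} (he : Function.Injective e)
    (hl : ∀ i, ((cuckooGraph S h₁ h₂).deleteEdges (T : Set U)).IsLink (e i) (v i) (v (i + 1))) :
    (∀ i, p (e i) ∈ Set.range v) ∧ (∀ i, ∃ j, p (e j) = v i) ∧
      (∀ i, kick h₁ h₂ (S \ T) p (v i) ∈ Set.range v) ∧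
      ∀ i j, ∃ a, (kick h₁ h₂ (S \ T) p)^[a] (v i) = v j := by
  have hI : ∀ i, e i ∈ S \ T := fun i => (deleteEdges_cuckooGraph_isLink.1 (hl i)).1
  have hex : ∀ i, ∃ j, p (e i) = v j ∧ (j = i ∨ j = i + 1) := fun i => by
    rcases hp.eq_or_eq_of_isLink (hl i) with h | h
    · exact ⟨i, h, Or.inl rfl⟩
    · exact ⟨i + 1, h, Or.inr rfl⟩
  choose σ hσ hσ' using hex
  have hσi : Function.Injective σ := fun i j hij =>
    he (hp.inj (hI i) (hI j) (by rw [hσ, hσ, hij]))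
  have hkick : ∀ i, kick h₁ h₂ (S \ T) p (v (σ i)) = otherCell h₁ h₂ (e i) (v (σ i)) := fun i => by
    rw [← hσ, hp.kick_apply (hI i)]
  have horbit : ∀ i j, ∃ a, (kick h₁ h₂ (S \ T) p)^[a] (v i) = v j := by
    by_cases hall : ∀ i, σ i = i
    · intro i j
      obtain ⟨a, rfl⟩ := iterate_add_one_surj i j
      refine ⟨a, ?_⟩
      have : Function.Semiconj v (· + 1) (kick h₁ h₂ (S \ T) p) := fun i => by
        have := hkick i
        rw [hall i, (otherCell_of_isLink (hl i)).1] at this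
        exact this.symm
      exact ((this.iterate_right a) i).symm
    · push Not at hall
      obtain ⟨i₀, hi₀⟩ := hall
      -- If one key is stored at the later end point of its edge, then so is the key of the
      -- next edge, because their cells differ.
      have hback : ∀ a, σ ((· + 1)^[a] i₀) = (· + 1)^[a] i₀ + 1 := by
        intro a
        induction a with
        | zero => exact (hσ' i₀).resolve_left hi₀
        | succ a ih =>
          rw [Function.iterate_succ_apply']
          rcases hσ' ((· + 1)^[a] i₀ + 1) with h | h
          · have := hσi (h.trans ih.symm)
            rw [this, ih, this]
          · exact h
      have hall : ∀ i, kick h₁ h₂ (S \ T) p (v (i + 1)) = v i := fun i => by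
        obtain ⟨a, rfl⟩ := iterate_add_one_surj i₀ i
        have := hkick ((· + 1)^[a] i₀)
        rwa [hback, (otherCell_of_isLink (hl _)).2] at this
      intro j i
      obtain ⟨a, rfl⟩ := iterate_add_one_surj i j
      refine ⟨a, ?_⟩
      induction a with
      | zero => rfl
      | succ a ih =>
        rw [Function.iterate_succ_apply' (· + 1), Function.iterate_succ_apply (kick _ _ _ _), hall,
          ih]
  refine ⟨fun i => ⟨σ i, (hσ i).symm⟩, fun i => ?_, fun i => ?_, horbit⟩
  · obtain ⟨j, rfl⟩ := (Finite.injective_iff_surjective.1 hσi) i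
    exact ⟨j, hσ j⟩
  · obtain ⟨j, rfl⟩ := (Finite.injective_iff_surjective.1 hσi) i
    rw [hkick]
    rcases hσ' j with h | h
    · rw [h, (otherCell_of_isLink (hl j)).1]
      exact ⟨_, rfl⟩
    · rw [h, (otherCell_of_isLink (hl j)).2]
      exact ⟨_, rfl⟩

/-- Two cycles of one component coincide: the kicks from both of them meet, so that they have a
node in common, and the kicks from this node traverse both cycles. -/
theorem IsStorage.cycle_subset (hp : IsStorage h₁ h₂ (S \ T) p) {u : Fin m ⊕ Fin m}
    {C C' : Set U}
    (hC : IsCycleIn ((cuckooGraph S h₁ h₂).deleteEdges (T : Set U))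
      (component ((cuckooGraph S h₁ h₂).deleteEdges (T : Set U)) u) C)
    (hC' : IsCycleIn ((cuckooGraph S h₁ h₂).deleteEdges (T : Set U))
      (component ((cuckooGraph S h₁ h₂).deleteEdges (T : Set U)) u) C') : C ⊆ C' := by
  obtain ⟨r, v, e, -, he, hW, hl, rfl⟩ := hC
  obtain ⟨r', v', e', -, he', hW', hl', rfl⟩ := hC'
  obtain ⟨h1, h2, h3, h4⟩ := hp.cycle_spec he hl
  obtain ⟨h1', h2', h3', h4'⟩ := hp.cycle_spec he' hl'
  obtain ⟨a, b, hab⟩ := hp.exists_iterate_eq_of_mem_component (hW 0)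
  obtain ⟨a', b', hab'⟩ := hp.exists_iterate_eq_of_mem_component (hW' 0)
  have hclosed : ∀ {r} {v : Fin (r + 1) → Fin m ⊕ Fin m},
      (∀ i, kick h₁ h₂ (S \ T) p (v i) ∈ Set.range v) →
      ∀ a, ∀ w ∈ Set.range v, (kick h₁ h₂ (S \ T) p)^[a] w ∈ Set.range v := by
    intro r v h a
    induction a with
    | zero => exact fun w hw => hw
    | succ a ih =>
      rintro _ ⟨i, rfl⟩
      exact ih _ (h i)
  -- The kicks from both cycles meet in a node `z`, which lies on both cycles.
  have hz : (kick h₁ h₂ (S \ T) p)^[a' + b] (v 0) = (kick h₁ h₂ (S \ T) p)^[a + b'] (v' 0) := by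
    rw [Function.iterate_add_apply, ← hab, ← Function.iterate_add_apply, add_comm,
      Function.iterate_add_apply, hab', ← Function.iterate_add_apply]
  obtain ⟨i, hi⟩ := hclosed h3 (a' + b) _ ⟨0, rfl⟩
  have hi' := hclosed h3' (a + b') _ ⟨0, rfl⟩
  rw [← hz, ← hi] at hi'
  rintro _ ⟨j, rfl⟩
  obtain ⟨j₁, hj₁⟩ := h1 j
  obtain ⟨d, hd⟩ := h4 i j₁
  obtain ⟨j₂, hj₂⟩ := hclosed h3' d _ hi'
  obtain ⟨j₃, hj₃⟩ := h2' j₂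
  refine ⟨j₃, hp.inj (deleteEdges_cuckooGraph_isLink.1 (hl' j₃)).1
    (deleteEdges_cuckooGraph_isLink.1 (hl j)).1 ?_⟩
  rw [hj₃, hj₂, hd, hj₁]

/-- Removing the keys in the stash leaves components with at most one cycle each. -/
theorem excess_le_of_canStore {s : ℕ} (h : CanStore S h₁ h₂ s) :
    excess (cuckooGraph S h₁ h₂) ≤ s := by
  obtain ⟨T, hTS, hTs, p, hmem, hinj⟩ := h
  have hp : IsStorage h₁ h₂ (S \ T) p :=
    ⟨fun x hx => hmem x (mem_sdiff.1 hx).1 (mem_sdiff.1 hx).2, by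
      rw [coe_sdiff]; exact hinj⟩
  refine (iInf₂_le_of_le (T : Set U) (fun x hx => hTS hx) (iInf_le_of_le ?_ ?_) :
    excess (cuckooGraph S h₁ h₂) ≤ (T : Set U).encard).trans ?_
  · intro v _
    by_cases hC : ∃ C, IsCycleIn ((cuckooGraph S h₁ h₂).deleteEdges (T : Set U))
        (component ((cuckooGraph S h₁ h₂).deleteEdges (T : Set U)) v) C
    · obtain ⟨C, hC⟩ := hC
      exact Or.inr ⟨C, hC, fun C' hC' =>
        (hp.cycle_subset hC' hC).antisymm (hp.cycle_subset hC hC')⟩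
    · exact Or.inl hC
  · exact le_rfl
  · rw [Set.encard_coe_eq_coe_finsetCard]
    exact_mod_cast hTs

end Excess

/-! ### Edge lists with bounds for the exploration -/

section ExploredEdges

variable {m : ℕ}

/-- The edge lists of length `t` explored with at most `R` exceptional moves and at most `V` free
choices of a node. -/
def exploredEdges (m R V t : ℕ) : Set (List (Fin m × Fin m)) :=
  {E | E.length = t ∧ ∃ w r v, r ≤ R ∧ v ≤ V ∧ Explored E w r v}

theorem encard_exploredEdges_le (hm : 0 < m) (R V t : ℕ) :
    (exploredEdges m R V t).encard
      ≤ ((R + 1) * (V + 1) * (m ^ V * (2 * (t + 1) ^ 2) ^ R) : ℕ) := by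
  have hfin : ∀ r v, (exploredSet m r t v).Finite := fun r v =>
    Set.finite_of_encard_le_coe (encard_exploredSet_le hm r t v)
  refine encard_le_of_forall_mem
    (A := ((range (R + 1) ×ˢ range (V + 1) : Finset (ℕ × ℕ)) : Set (ℕ × ℕ)))
    (by rw [Set.encard_coe_eq_coe_finsetCard]; simp)
    (fun q => (hfin q.1 q.2).toFinset.image Prod.fst) ?_ ?_
  · rintro ⟨r, v⟩ hq
    simp only [coe_product, Set.mem_prod, mem_coe, mem_range] at hq
    refine card_image_le.trans ?_
    have h := encard_exploredSet_le hm r t v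
    rw [(hfin r v).encard_eq_coe_toFinset_card] at h
    refine (ENat.natCast_le_natCast.1 h).trans ?_
    have hX : 1 ≤ 2 * (t + 1) ^ 2 := Nat.succ_le_of_lt (by positivity)
    gcongr <;> omega
  · rintro E ⟨ht, w, r, v, hr, hv, hE⟩
    refine ⟨(r, v), by simp; omega, mem_image.2 ⟨(E, w), ?_, rfl⟩⟩
    rw [Set.Finite.mem_toFinset]
    exact ⟨ht, hE⟩

end ExploredEdges

/-! ### First moments -/

section FirstMoment

variable {U : Type*} {m l c k : ℕ} {Hm : Finset (U → Fin m)} {Hl : Finset (U → Fin l)}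

/-- All functions `g j` shrink the set of keys in `L` by at least `k`. -/
def Shrinking (k : ℕ) (g : Fin c → ↥Hl) (L : List U) : Prop :=
  ∀ j, (L.toFinset.image (g j : U → Fin l)).card + k ≤ L.toFinset.card

/-- Some function `g j` shrinks the set of keys in `L` by at most `k`, so that the hash functions
are uniform on `L`. -/
def Spread (k : ℕ) (g : Fin c → ↥Hl) (L : List U) : Prop :=
  ∃ j, L.toFinset.card ≤ (L.toFinset.image (g j : U → Fin l)).card + k

/-- Keys enter a list one at a time, so that a list shrunk by at least `k` has a final segment that
is shrunk by at least `k`, and by exactly `k` under one of the functions. -/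
theorem Shrinking.exists_suffix (hc : 0 < c) (hk : 0 < k) {g : Fin c → ↥Hl} {L : List U}
    (hL : L.Nodup) (h : Shrinking k g L) :
    ∃ L', L' <:+ L ∧ Shrinking k g L' ∧ Spread k g L' := by
  induction L with
  | nil =>
    have := h ⟨0, hc⟩
    simp at this
    omega
  | cons x L ih =>
    have hL' := List.nodup_cons.1 hL
    by_cases h' : Shrinking k g L
    · obtain ⟨L', h1, h2⟩ := ih hL'.2 h'
      exact ⟨L', h1.trans (List.suffix_cons x L), h2⟩
    · refine ⟨x :: L, List.suffix_rfl, h, ?_⟩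
      obtain ⟨j, hj⟩ := not_forall.1 h'
      refine ⟨j, ?_⟩
      have h1 : (x :: L).toFinset.card = L.toFinset.card + 1 := by
        rw [List.toFinset_cons, card_insert_of_notMem (by simpa using hL'.1)]
      have h2 : (L.toFinset.image (g j : U → Fin l)).card
          ≤ ((x :: L).toFinset.image (g j : U → Fin l)).card := by
        rw [List.toFinset_cons]
        exact card_le_card (image_subset_image (subset_insert _ _))
      omega

/-- The edges of `L` take each value with the probability `m ^ (-2 t)` of uniform hash functions.
-/
theorem unifProb_edges_mem_le [Finite U] (hHm : KWiseIndependent (2 * k) Hm)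
    (hHl : Hl.Nonempty) (hU : 2 * k ≤ Nat.card U) (hm : 0 < m) {L : List U} (hL : L.Nodup)
    (Q : (Fin c → ↥Hl) → Prop) (hQ : ∀ g, Q g → Spread k g L) {A : Set (List (Fin m × Fin m))}
    {N : ℕ} (hA : A.encard ≤ N) :
    unifProb (fun ω : ZFamily Hm Hl c => Q ω.g ∧ edges ω.h₁ ω.h₂ L ∈ A)
      ≤ N * (unifProb Q / (m : ℝ) ^ (2 * L.length)) := by
  have hfin : A.Finite := Set.finite_of_encard_le_coe hA
  rw [hfin.encard_eq_coe_toFinset_card] at hA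
  have hN := ENat.natCast_le_natCast.1 hA
  have hβ : 0 ≤ unifProb Q / (m : ℝ) ^ (2 * L.length) := by
    unfold unifProb
    positivity
  have key : ∀ E, unifProb (fun ω : ZFamily Hm Hl c => Q ω.g ∧ edges ω.h₁ ω.h₂ L = E)
      ≤ unifProb Q / (m : ℝ) ^ (2 * L.length) := by
    intro E
    by_cases hex : ∃ ω : ZFamily Hm Hl c, edges ω.h₁ ω.h₂ L = E
    · obtain ⟨ω₀, rfl⟩ := hex
      have h := unifProb_matching_le hHm hHl hU hm L.toFinset Q hQ ω₀.h₁ ω₀.h₂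
      rw [List.toFinset_card_of_nodup hL] at h
      refine (unifProb_mono fun ω hω => ⟨hω.1, fun x hx => ?_⟩).trans h
      have := List.map_inj_left.1 hω.2 x (by simpa using hx)
      simpa using this
    · refine le_trans (le_of_eq ?_) hβ
      have : IsEmpty {ω : ZFamily Hm Hl c // Q ω.g ∧ edges ω.h₁ ω.h₂ L = E} :=
        ⟨fun ω => hex ⟨ω.1, ω.2.2⟩⟩
      unfold unifProb
      rw [Nat.card_of_isEmpty, Nat.cast_zero, zero_div]
  calc _ ≤ unifProb (fun ω : ZFamily Hm Hl c =>
        ∃ E ∈ hfin.toFinset, Q ω.g ∧ edges ω.h₁ ω.h₂ L = E) :=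
        unifProb_mono fun ω hω => ⟨_, hfin.mem_toFinset.2 hω.2, hω.1, rfl⟩
    _ ≤ ∑ E ∈ hfin.toFinset, unifProb (fun ω : ZFamily Hm Hl c =>
        Q ω.g ∧ edges ω.h₁ ω.h₂ L = E) := unifProb_exists_le _ _
    _ ≤ ∑ E ∈ hfin.toFinset, unifProb Q / (m : ℝ) ^ (2 * L.length) :=
        sum_le_sum fun E _ => key E
    _ ≤ _ := by
        rw [sum_const, nsmul_eq_mul]
        gcongr

/-- The union bound over the `n ^ t` lists of `t` keys of `S`. -/
theorem unifProb_exists_list_le [Finite U] (hHm : KWiseIndependent (2 * k) Hm)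
    (hHl : Hl.Nonempty) (hU : 2 * k ≤ Nat.card U) (hm : 0 < m) (S : Finset U) (t : ℕ)
    (Q : List U → (Fin c → ↥Hl) → Prop) (hQ : ∀ L g, Q L g → Spread k g L) {β : ℝ}
    (hβ : 0 ≤ β) (hQβ : ∀ L : List U, L.Nodup → L.length = t → unifProb (Q L) ≤ β)
    {A : Set (List (Fin m × Fin m))} {N : ℕ} (hA : A.encard ≤ N) :
    unifProb (fun ω : ZFamily Hm Hl c => ∃ L : List U, L.Nodup ∧ (∀ x ∈ L, x ∈ S) ∧
        L.length = t ∧ Q L ω.g ∧ edges ω.h₁ ω.h₂ L ∈ A)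
      ≤ (S.card : ℝ) ^ t * (N * (β / (m : ℝ) ^ (2 * t))) := by
  have key : ∀ y : Fin t → U, unifProb (fun ω : ZFamily Hm Hl c =>
      (List.ofFn y).Nodup ∧ Q (List.ofFn y) ω.g ∧ edges ω.h₁ ω.h₂ (List.ofFn y) ∈ A)
      ≤ N * (β / (m : ℝ) ^ (2 * t)) := by
    intro y
    by_cases hy : (List.ofFn y).Nodup
    · refine (unifProb_mono fun ω hω => hω.2).trans
        ((unifProb_edges_mem_le hHm hHl hU hm hy _ (hQ _) hA).trans ?_)
      rw [List.length_ofFn]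
      gcongr
      exact hQβ _ hy List.length_ofFn
    · have : IsEmpty {ω : ZFamily Hm Hl c //
          (List.ofFn y).Nodup ∧ Q (List.ofFn y) ω.g ∧ edges ω.h₁ ω.h₂ (List.ofFn y) ∈ A} :=
        ⟨fun ω => hy ω.2.1⟩
      unfold unifProb
      rw [Nat.card_of_isEmpty, Nat.cast_zero, zero_div]
      positivity
  calc _ ≤ unifProb (fun ω : ZFamily Hm Hl c => ∃ y ∈ Fintype.piFinset fun _ : Fin t => S,
        (List.ofFn y).Nodup ∧ Q (List.ofFn y) ω.g ∧ edges ω.h₁ ω.h₂ (List.ofFn y) ∈ A) := by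
        refine unifProb_mono ?_
        rintro ω ⟨L, h1, h2, rfl, h4, h5⟩
        refine ⟨L.get, Fintype.mem_piFinset.2 fun i => h2 _ (L.get_mem i), ?_⟩
        rw [List.ofFn_get]
        exact ⟨h1, h4, h5⟩
    _ ≤ ∑ y ∈ Fintype.piFinset fun _ : Fin t => S, (N * (β / (m : ℝ) ^ (2 * t)) : ℝ) :=
        (unifProb_exists_le _ _).trans (sum_le_sum fun y _ => key y)
    _ = _ := by
        rw [sum_const, nsmul_eq_mul, Fintype.card_piFinset]
        simp

end FirstMoment

/-! ### Estimates for the series -/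

section Estimates

/-- The polynomial factor in the first moment bounds for lists of `t` keys. -/
def polyFactor (R : ℕ) (t : ℕ) : ℝ := (R + 1) * (t + 2) * (2 * ((t : ℝ) + 1) ^ 2) ^ R

theorem summable_polyFactor (R d : ℕ) {q : ℝ} (hq0 : 0 < q) (hq1 : q < 1) :
    Summable fun t : ℕ => polyFactor R t * ((t : ℝ) ^ 2 + 1) ^ d * q ^ t := by
  have h := (summable_nat_add_iff 2).2 (summable_pow_mul_geometric_of_norm_lt_one
    (1 + 2 * R + 2 * d) (r := q) (by rwa [Real.norm_of_nonneg hq0.le]))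
  refine Summable.of_nonneg_of_le (fun t => by unfold polyFactor; positivity) (fun t => ?_)
    (h.mul_left (((R : ℝ) + 1) * 2 ^ R * (q ^ 2)⁻¹))
  have h1 : (t : ℝ) + 1 ≤ t + 2 := by linarith
  have h2 : (t : ℝ) ^ 2 + 1 ≤ (t + 2) ^ 2 := by nlinarith [Nat.cast_nonneg (α := ℝ) t]
  calc polyFactor R t * ((t : ℝ) ^ 2 + 1) ^ d * q ^ t
      ≤ ((R + 1) * (t + 2) * (2 * ((t : ℝ) + 2) ^ 2) ^ R) * ((t + 2) ^ 2) ^ d * q ^ t := by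
        unfold polyFactor
        gcongr
    _ = ((R + 1) * 2 ^ R * (q ^ 2)⁻¹) *
        (((t + 2 : ℕ) : ℝ) ^ (1 + 2 * R + 2 * d) * q ^ (t + 2)) := by
        rw [mul_pow 2, ← pow_mul, ← pow_mul, pow_add, pow_add, pow_one, pow_add q]
        push_cast
        field_simp

/-- The hypothesis on `c` in the form in which it is used, `l ^ (k c)` being `n ^ (δ k c)` up to
the rounding of `n ^ δ`, which costs at most a factor `2`. -/
theorem pow_le_of_floor_rpow_le {n l k c s : ℕ} {δ : ℝ} (hn : 1 ≤ n) (hδ : 0 < δ)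
    (hk : 1 ≤ k) (hc : ((s : ℝ) + 2) / (δ * (k : ℝ)) ≤ (c : ℝ)) (hl : ⌊(n : ℝ) ^ δ⌋₊ ≤ l) :
    (n : ℝ) ^ (s + 2) ≤ 2 ^ (k * c) * (l : ℝ) ^ (k * c) := by
  have hn' : (1 : ℝ) ≤ n := by exact_mod_cast hn
  have hk' : (1 : ℝ) ≤ k := by exact_mod_cast hk
  have hx : 1 ≤ (n : ℝ) ^ δ := Real.one_le_rpow hn' hδ.le
  have h1 : (n : ℝ) ^ δ ≤ 2 * l := by
    have h2 : (1 : ℝ) ≤ ⌊(n : ℝ) ^ δ⌋₊ := by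
      exact_mod_cast (Nat.one_le_floor_iff _).2 hx
    have h3 := Nat.lt_floor_add_one ((n : ℝ) ^ δ)
    have h4 : (⌊(n : ℝ) ^ δ⌋₊ : ℝ) ≤ l := by exact_mod_cast hl
    linarith
  rw [div_le_iff₀ (by positivity)] at hc
  rw [← mul_pow]
  calc (n : ℝ) ^ (s + 2) = (n : ℝ) ^ ((s + 2 : ℕ) : ℝ) := (Real.rpow_natCast _ _).symm
    _ ≤ (n : ℝ) ^ (δ * (k * c : ℕ)) := by
        refine Real.rpow_le_rpow_of_exponent_le hn' ?_
        push_cast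
        linarith
    _ = ((n : ℝ) ^ δ) ^ (k * c) := by rw [Real.rpow_mul (by positivity), Real.rpow_natCast]
    _ ≤ _ := by gcongr

/-- The bound for lists of `t` keys with `V = t - (s + 1)` free nodes on which the hash functions
are uniform. -/
theorem good_estimate {n m R V t s : ℕ} {ε : ℝ} (hε : 0 < ε) (hn : 1 ≤ n)
    (hm : (1 + ε) * (n : ℝ) ≤ m) (hV : V + (s + 1) = t) :
    (n : ℝ) ^ t * (((R + 1) * (V + 1) * (m ^ V * (2 * (t + 1) ^ 2) ^ R) : ℕ)
        * (1 / (m : ℝ) ^ (2 * t)))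
      ≤ polyFactor R t * (1 / (1 + ε)) ^ t / (n : ℝ) ^ (s + 1) := by
  have hn' : (1 : ℝ) ≤ n := by exact_mod_cast hn
  have hnm : (n : ℝ) ≤ m := by nlinarith
  have hm0 : (0 : ℝ) < m := by linarith
  have hq : (n : ℝ) / m ≤ 1 / (1 + ε) := by
    rw [div_le_div_iff₀ hm0 (by positivity)]
    linarith
  have hVt : (V : ℝ) + 1 ≤ t + 2 := by
    have : V ≤ t := by omega
    have : (V : ℝ) ≤ t := by exact_mod_cast this
    linarith
  have hpow : (m : ℝ) ^ (2 * t) = m ^ V * m ^ (s + 1) * m ^ t := by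
    rw [← pow_add, ← pow_add]
    congr 1
    omega
  calc _ = (R + 1) * ((V : ℝ) + 1) * (2 * ((t : ℝ) + 1) ^ 2) ^ R * (n / m) ^ t
        / (m : ℝ) ^ (s + 1) := by
        rw [hpow, div_pow]
        push_cast
        field_simp
    _ ≤ _ := by
        unfold polyFactor
        gcongr

/-- The bound for exceptional lists of `t` keys, with up to `t + 1` free nodes. The factor
`m ^ (t + 1)` exceeds `m ^ t` by a factor `m`, which need not be `O(n)`; it is absorbed by one of the
factors `n / m`, which is possible since the empty list is not exceptional. -/
theorem critical_estimate {n m l R t s d : ℕ} {ε : ℝ} (hε : 0 < ε) (hn : 1 ≤ n)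
    (hm : (1 + ε) * (n : ℝ) ≤ m) (hd : 0 < d)
    (hl : (n : ℝ) ^ (s + 2) ≤ 2 ^ d * (l : ℝ) ^ d) :
    (n : ℝ) ^ t * (((R + 1) * (t + 1 + 1) * (m ^ (t + 1) * (2 * (t + 1) ^ 2) ^ R) : ℕ)
        * (((t : ℝ) ^ 2 / l) ^ d / (m : ℝ) ^ (2 * t)))
      ≤ (1 + ε) * 2 ^ d * (polyFactor R t * ((t : ℝ) ^ 2 + 1) ^ d * (1 / (1 + ε)) ^ t)
        / (n : ℝ) ^ (s + 1) := by
  have hn' : (1 : ℝ) ≤ n := by exact_mod_cast hn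
  have hm0 : (0 : ℝ) < m := by nlinarith
  have hq : (n : ℝ) / m ≤ 1 / (1 + ε) := by
    rw [div_le_div_iff₀ hm0 (by positivity)]
    linarith
  have hld : (0 : ℝ) < (l : ℝ) ^ d := by
    have : (0 : ℝ) < (n : ℝ) ^ (s + 2) := by positivity
    by_contra! h
    nlinarith [pow_pos (two_pos : (0 : ℝ) < 2) d]
  rcases t with _ | t
  · rw [Nat.cast_zero, zero_pow two_ne_zero, zero_div, zero_pow hd.ne', zero_div, mul_zero,
      mul_zero]
    unfold polyFactor
    positivity
  have hl' : 1 / (l : ℝ) ^ d ≤ 2 ^ d / (n : ℝ) ^ (s + 2) := by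
    rw [div_le_div_iff₀ hld (by positivity)]
    linarith
  have hpow : (m : ℝ) ^ (2 * (t + 1)) = m ^ (t + 1 + 1) * m ^ t := by
    rw [← pow_add]
    congr 1
    omega
  calc _ = polyFactor R (t + 1) * (((t + 1 : ℕ) : ℝ) ^ 2) ^ d * ((n / m) ^ t * n)
        * (1 / (l : ℝ) ^ d) := by
        rw [hpow, div_pow, div_pow, polyFactor]
        push_cast
        field_simp
        ring
    _ ≤ polyFactor R (t + 1) * (((t + 1 : ℕ) : ℝ) ^ 2 + 1) ^ d * ((1 / (1 + ε)) ^ t * n)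
        * (2 ^ d / (n : ℝ) ^ (s + 2)) := by
        have : 0 ≤ polyFactor R (t + 1) := by unfold polyFactor; positivity
        gcongr
        linarith
    _ = _ := by
        rw [pow_succ (1 / (1 + ε)) t, pow_succ (n : ℝ) (s + 1)]
        field_simp

end Estimates

/-! ### The failure probability -/

section Failure

variable {U : Type*} {m l c k : ℕ} {Hm : Finset (U → Fin m)} {Hl : Finset (U → Fin l)}

/-- A failure is witnessed by an explored list of keys of one of two kinds: a list with `s + 1`
fewer free nodes than edges on which the hash functions are uniform, or a list that is just shrunk
enough to be exceptional for all `g j`, but on which the hash functions still are uniform. -/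
theorem exists_list_of_not_canStore {S : Finset U} {s : ℕ} (hc : 0 < c) (hk : 0 < k)
    (ω : ZFamily Hm Hl c) (h : ¬ CanStore S ω.h₁ ω.h₂ s) :
    (∃ t ∈ (range (S.card + 1)).filter (s + 1 ≤ ·), ∃ L : List U, L.Nodup ∧ (∀ x ∈ L, x ∈ S) ∧
      L.length = t ∧ Spread k ω.g L ∧
      edges ω.h₁ ω.h₂ L ∈ exploredEdges m (4 * (s + 1)) (t - (s + 1)) t) ∨
    ∃ t ∈ range (S.card + 1), ∃ L : List U, L.Nodup ∧ (∀ x ∈ L, x ∈ S) ∧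
      L.length = t ∧ (Shrinking k ω.g L ∧ Spread k ω.g L) ∧
      edges ω.h₁ ω.h₂ L ∈ exploredEdges m (4 * (s + 1)) (t + 1) t := by
  obtain ⟨L, r, v, hL, hLS, hE, hr, hv⟩ := exists_explored_of_not_canStore h
  have hlen : ∀ L : List U, L.Nodup → (∀ x ∈ L, x ∈ S) → L.length < S.card + 1 := by
    intro L hL hLS
    rw [← List.toFinset_card_of_nodup hL]
    exact Nat.lt_succ_of_le (card_le_card fun x hx => hLS x (by simpa using hx))
  by_cases hspread : Spread k ω.g L
  · refine Or.inl ⟨L.length, ?_, L, hL, hLS, rfl, hspread, by simp [edges], none, r, v, hr,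
      by omega, hE⟩
    exact mem_filter.2 ⟨mem_range.2 (hlen L hL hLS), by omega⟩
  · have hshrink : Shrinking k ω.g L := fun j =>
      (le_total _ _).resolve_right fun h => hspread ⟨j, h⟩
    obtain ⟨L', hsuf, h1, h2⟩ := hshrink.exists_suffix hc hk hL
    have hL' := hL.sublist hsuf.sublist
    have hLS' : ∀ x ∈ L', x ∈ S := fun x hx => hLS x (hsuf.subset hx)
    obtain ⟨w', r', v', hr', hE'⟩ := hE.suffix (E' := edges ω.h₁ ω.h₂ L') (hsuf.map _)
    refine Or.inr ⟨L'.length, mem_range.2 (hlen L' hL' hLS'), L', hL', hLS', rfl, ⟨h1, h2⟩,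
      by simp [edges], w', r', v', by omega, ?_, hE'⟩
    simpa [edges] using hE'.le_length

/-- The failure probability if there are enough keys for the independence to be effective. -/
theorem unifProb_not_canStore_le [Finite U] (hHm : KWiseIndependent (2 * k) Hm)
    (hHl : KWiseIndependent (2 * k) Hl) {ε : ℝ} (hε : 0 < ε) (hk : 0 < k) (hc : 0 < c)
    {S : Finset U} {s : ℕ} (hS : 1 ≤ S.card) (hU : 2 * k ≤ S.card)
    (hm : (1 + ε) * (S.card : ℝ) ≤ m) (hl0 : 0 < l)
    (hl : (S.card : ℝ) ^ (s + 2) ≤ 2 ^ (k * c) * (l : ℝ) ^ (k * c)) :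
    unifProb (fun ω : ZFamily Hm Hl c => ¬ CanStore S ω.h₁ ω.h₂ s)
      ≤ ((1 + (1 + ε) * 2 ^ (k * c)) * ∑' t : ℕ, polyFactor (4 * (s + 1)) t *
        ((t : ℝ) ^ 2 + 1) ^ (k * c) * (1 / (1 + ε)) ^ t) / (S.card : ℝ) ^ (s + 1) := by
  set R := 4 * (s + 1) with hR
  set n := S.card with hn
  have hU' : 2 * k ≤ Nat.card U := by
    have h := Finite.card_subtype_le (fun x => x ∈ S)
    rw [Nat.card_eq_finsetCard] at h
    omega
  have hm0 : 0 < m := by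
    have : (1 : ℝ) ≤ n := by exact_mod_cast hS
    have : (0 : ℝ) < m := by nlinarith
    exact_mod_cast this
  have hq1 : 1 / (1 + ε) < 1 := by
    rw [div_lt_one (by positivity)]
    linarith
  have hsum := summable_polyFactor R (k * c) (q := 1 / (1 + ε)) (by positivity) hq1
  set A : ℕ → ℝ := fun t => polyFactor R t * ((t : ℝ) ^ 2 + 1) ^ (k * c) * (1 / (1 + ε)) ^ t
    with hA
  have hP : ∀ t, 0 ≤ polyFactor R t := fun t => by unfold polyFactor; positivity
  have hA0 : ∀ t, 0 ≤ A t := fun t => by have := hP t; positivity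
  have hgood : ∀ t ∈ (range (n + 1)).filter (s + 1 ≤ ·),
      unifProb (fun ω : ZFamily Hm Hl c => ∃ L : List U, L.Nodup ∧ (∀ x ∈ L, x ∈ S) ∧
        L.length = t ∧ Spread k ω.g L ∧ edges ω.h₁ ω.h₂ L ∈ exploredEdges m R (t - (s + 1)) t)
      ≤ A t / (n : ℝ) ^ (s + 1) := by
    intro t ht
    refine (unifProb_exists_list_le hHm hHl.1 hU' hm0 S t (fun L g => Spread k g L)
      (fun L g h => h) zero_le_one (fun L _ _ => unifProb_le_one _)
      (encard_exploredEdges_le hm0 R (t - (s + 1)) t)).trans ?_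
    refine (good_estimate hε hS hm (Nat.sub_add_cancel (mem_filter.1 ht).2)).trans ?_
    have := hP t
    simp only [hA]
    gcongr
    refine le_mul_of_one_le_right this (one_le_pow₀ ?_)
    nlinarith
  have hcrit : ∀ t ∈ range (n + 1),
      unifProb (fun ω : ZFamily Hm Hl c => ∃ L : List U, L.Nodup ∧ (∀ x ∈ L, x ∈ S) ∧
        L.length = t ∧ (Shrinking k ω.g L ∧ Spread k ω.g L) ∧
        edges ω.h₁ ω.h₂ L ∈ exploredEdges m R (t + 1) t)
      ≤ (1 + ε) * 2 ^ (k * c) * A t / (n : ℝ) ^ (s + 1) := by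
    intro t _
    refine (unifProb_exists_list_le hHm hHl.1 hU' hm0 S t
      (fun L g => Shrinking k g L ∧ Spread k g L) (fun L g h => h.2)
      (β := ((t : ℝ) ^ 2 / l) ^ (k * c)) (by positivity) (fun L hL hLt => ?_)
      (encard_exploredEdges_le hm0 R (t + 1) t)).trans
      (critical_estimate hε hS hm (Nat.mul_pos hk hc) hl)
    have h := unifProb_shrink_le (c := c) hHl hU' hl0 L.toFinset
    rw [List.toFinset_card_of_nodup hL, hLt] at h
    refine (unifProb_mono fun g hg => ?_).trans h
    intro j
    have := hg.1 j
    rwa [List.toFinset_card_of_nodup hL, hLt] at this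
  have hfin : ∀ F : Finset ℕ, ∑ t ∈ F, A t ≤ ∑' t, A t := fun F =>
    hsum.sum_le_tsum F fun t _ => hA0 t
  calc _ ≤ _ := unifProb_mono fun ω hω => exists_list_of_not_canStore hc hk ω hω
    _ ≤ _ := unifProb_or_le _ _
    _ ≤ _ := add_le_add ((unifProb_exists_le _ _).trans (sum_le_sum hgood))
        ((unifProb_exists_le _ _).trans (sum_le_sum hcrit))
    _ ≤ (∑' t, A t) / (n : ℝ) ^ (s + 1)
        + (1 + ε) * 2 ^ (k * c) * (∑' t, A t) / (n : ℝ) ^ (s + 1) := by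
        rw [← sum_div, ← sum_div, ← mul_sum]
        gcongr <;> exact hfin _
    _ = _ := by ring

end Failure

end CuckooStash

end

theorem theorem1 (ε δ : ℝ) (hε : 0 < ε) (hδ0 : 0 < δ) (hδ1 : δ < 1)
    (s k c : ℕ) (hk : 1 ≤ k) (hc : ((s : ℝ) + 2) / (δ * (k : ℝ)) ≤ (c : ℝ)) :
    ∃ K : ℝ, ∀ (n m l : ℕ), 1 ≤ n → (1 + ε) * (n : ℝ) ≤ (m : ℝ) →
      ⌊(n : ℝ) ^ δ⌋₊ ≤ l → l ≤ ⌈(n : ℝ) ^ δ⌉₊ →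
      ∀ (U : Type u) [Finite U] (Hm : Finset (U → Fin m)) (Hl : Finset (U → Fin l)),
        CuckooStash.KWiseIndependent (2 * k) Hm →
        CuckooStash.KWiseIndependent (2 * k) Hl →
        ∀ S : Finset U, S.card = n →
          CuckooStash.unifProb (fun ω : CuckooStash.ZFamily Hm Hl c =>
              ((s + 1 : ℕ) : ℕ∞) ≤ CuckooStash.excess (CuckooStash.cuckooGraph S ω.h₁ ω.h₂))
            ≤ K / (n : ℝ) ^ (s + 1) ∧
          CuckooStash.unifProb (fun ω : CuckooStash.ZFamily Hm Hl c =>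
              ¬ CuckooStash.CanStore S ω.h₁ ω.h₂ s)
            ≤ K / (n : ℝ) ^ (s + 1) := by
  have hc0 : 0 < c := by
    have h1 : (0 : ℝ) < k := by exact_mod_cast hk
    have h2 : (0 : ℝ) < c := lt_of_lt_of_le (by positivity) hc
    exact_mod_cast h2
  refine ⟨max ((2 * k : ℝ) ^ (s + 1)) ((1 + (1 + ε) * 2 ^ (k * c)) *
    ∑' t : ℕ, CuckooStash.polyFactor (4 * (s + 1)) t * ((t : ℝ) ^ 2 + 1) ^ (k * c) *
      (1 / (1 + ε)) ^ t), fun n m l hn hm hl _ U _ Hm Hl hHm hHl S hS => ?_⟩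
  subst hS
  have hn' : (1 : ℝ) ≤ S.card := by exact_mod_cast hn
  suffices key : CuckooStash.unifProb (fun ω : CuckooStash.ZFamily Hm Hl c =>
      ¬ CuckooStash.CanStore S ω.h₁ ω.h₂ s) ≤ _ by
    refine ⟨(CuckooStash.unifProb_mono fun ω hω hst => ?_).trans key, key⟩
    have h1 := hω.trans (CuckooStash.excess_le_of_canStore hst)
    have h2 := ENat.natCast_le_natCast.1 h1
    omega
  rcases le_total (2 * k) S.card with hU | hU
  · have hl0 : 0 < l := (Nat.floor_pos.2 (Real.one_le_rpow hn' hδ0.le)).trans_le hl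
    refine (CuckooStash.unifProb_not_canStore_le hHm hHl hε hk hc0 hn hU hm hl0
      (CuckooStash.pow_le_of_floor_rpow_le hn hδ0 hk hc hl)).trans ?_
    gcongr
    exact le_max_right _ _
  · -- For fewer than `2 k` keys, independence may hold vacuously, but `K` is large enough.
    refine (CuckooStash.unifProb_le_one _).trans ?_
    rw [one_le_div (by positivity)]
    refine le_max_of_le_left ?_
    gcongr
    exact_mod_cast hU
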